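/- **Setting.** Let $\mathbb K=\mathbb R$ or $\mathbb C$. A *Hilbert complex* $(W,\mathrm d)$ consists of Hilbert spaces $W^k$ ($k\in\mathbb Z$) and closed densely defined linear maps $\mathrm d^k\colon V^k\subset W^k\to W^{k+1}$ with $\mathrm d^kV^k\subset V^{k+1}$ and $\mathrm d^{k+1}\mathrm d^{k}=0$; it is *closed* if every $\mathfrak B^{k+1}=\mathrm d^kV^k$ is closed in $W^{k+1}$. The spaces $V^k$ form its domain complex. Put $\mathfrak Z^k=\ker\mathrm d^k$, $\mathfrak H^k=\mathfrak Z^k\cap(\mathfrak B^{k})^{\perp}$, and let $V_k^*$ be the domain of the adjoint $\mathrm d_k^*$ of $\mathrm d^{k-1}$. The complex has the *compactness property* if for every $k$ the inclusion $V^k\cap V^*_k\hookrightarrow W^k$ is compact, where $V^k\cap V_k^*$ has the norm $(\|u\|^2+\|\mathrm d u\|^2+\|\mathrm d^*u\|^2)^{1/2}$. A *morphism* of Hilbert complexes is a sequence of bounded maps $f^k\colon W^k\to W'^k$ with $f^kV^k\subset V'^k$ and $\mathrm d'^kf^k=f^{k+1}\mathrm d^k$. The *mixed problem* in degree $k$ with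 right-hand side $f\in W^k$ is to find $(\sigma,u,p)\in V^{k-1}\times V^k\times\mathfrak H^k$ with $$\langle\sigma,\tau\rangle-\langle u,\mathrm d\tau\rangle=0,\qquad \langle\mathrm d\sigma,v\rangle+\langle\mathrm du,\mathrm dv\rangle+\langle p,v\rangle=\langle f,v\rangle,\qquad \langle u,q\rangle=0$$ for all $\tau\in V^{k-1}$, $v\in V^k$, $q\in\mathfrak H^k$. Its solution operator is $K\colon W^k\to W^k$, $Kf=u$. The *eigenvalue problem* is the same system with $f=\lambda u$; an eigenvector is a nonzero $u$ arising in this way. **Theorem.** Let $(W,\mathrm d)$ be a closed Hilbert complex with the compactness property. Let $(W_h,\mathrm d_h)$ be a family of closed Hilbert complexes, with a parameter $h\to0$ (or, more generally, indexed by any set, the limits being taken along any filter on it), and let $i_h\colon W_h\to W$ and $\pi_h\colon W\to W_h$ be morphisms with $\pi_h^ki_h^k=\mathrm{id}$ for all $k$ and with $\|i_h^k\|$ and $\|\pi_h^k\|$ bounded uniformly in $h$ for each $k$. Assume also that for each $k$ $$\inf_{v\in V_h^k}\|u-i_h^kv\|\to0\ \text{ for every }u\in V^k,\qquad \|I-J_h^k\|\to0,\quad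 J_h^k=(i_h^k)^*i_h^k .$$ Then for every $k$ the discrete eigenvalue problems in degree $k$, i.e. those of the complexes $(W_h,\mathrm d_h)$ posed in $V_h^{k-1}\times V_h^k\times\mathfrak H_h^k$ with the inner products of $W_h$, converge to the eigenvalue problem of $(W,\mathrm d)$. This means the following. 1. The solution operators $K$ of $(W,\mathrm d)$ and $K_h$ of $(W_h,\mathrm d_h)$ exist, are uniquely determined and bounded, and $\|K-i_hK_hP_h\|\to0$ in $\mathcal L(W^k,W^k)$, where $P_h=\pi_hP_{i_hW_h}$ and $P_{i_hW_h}$ is the orthogonal projection of $W^k$ onto $i_hW_h^k$. 2. The eigenvalues of the exact problem, repeated according to multiplicity, can be listed in a nondecreasing finite or infinite sequence $(\lambda_n)_{1\le n\le N}$, $N\in\{0,1,\dots,\infty\}$, of real numbers with orthonormal eigenvectors $(u_n)$ such that each eigenspace is spanned by the $u_n$ belonging to it; and for each $h$ likewise $(\lambda_{n,h},u_{n,h})_{1\le n\le N_h}$ for the discrete problem. 3. For any choice of these lists: if $n\le N$, then $n\le N_h$ eventually, and $\lambda_{n,h}\to\lambda_n$; if $N<n<\infty$, then for every $M\in\mathbb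 R$ eventually either $N_h<n$ or $\lambda_{n,h}>M$; and for every finite $m\le N$ such that $m=0$, $m=N$ or $\lambda_m<\lambda_{m+1}$, $$\operatorname{gap}\bigl(\operatorname{span}\{u_1,\dots,u_m\},\; i_h\operatorname{span}\{u_{1,h},\dots,u_{m,h}\}\bigr)\to0,$$ where $\operatorname{gap}(E,F)=\max\bigl(\sup_{u\in E,\|u\|=1}\inf_{v\in F}\|u-v\|,\ \sup_{v\in F,\|v\|=1}\inf_{u\in E}\|u-v\|\bigr)$. -/

import Mathlib

open Filter Topology

noncomputable section

/-- A Hilbert complex on the Hilbert spaces `W k`, `k ∈ ℤ`: closed, densely defined, possibly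
unbounded operators `d k` from `W k` to `W (k + 1)`, with `d ∘ d = 0`.  The space `V k` of the
domain complex is `(d k).domain`. -/
structure HilbertComplex (𝕜 : Type*) [RCLike 𝕜] (W : ℤ → Type*)
    [∀ k, NormedAddCommGroup (W k)] [∀ k, InnerProductSpace 𝕜 (W k)]
    [∀ k, CompleteSpace (W k)] where
  d : ∀ k : ℤ, W k →ₗ.[𝕜] W (k + 1)
  dense_domain : ∀ k, Dense ((d k).domain : Set (W k))
  isClosed_d : ∀ k, (d k).IsClosed
  d_mem : ∀ k (u : (d k).domain), d k u ∈ (d (k + 1)).domain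
  d_d : ∀ k (u : (d k).domain), d (k + 1) ⟨d k u, d_mem k u⟩ = 0

namespace HilbertComplex

variable {𝕜 : Type*} [RCLike 𝕜]
  {W : ℤ → Type*} [∀ k, NormedAddCommGroup (W k)] [∀ k, InnerProductSpace 𝕜 (W k)]
  [∀ k, CompleteSpace (W k)]
  {W' : ℤ → Type*} [∀ k, NormedAddCommGroup (W' k)] [∀ k, InnerProductSpace 𝕜 (W' k)]
  [∀ k, CompleteSpace (W' k)]

/-- The `k`-cocycles: the kernel of `d k`, as a subspace of `W k`. -/
def cocycles (C : HilbertComplex 𝕜 W) (k : ℤ) : Submodule 𝕜 (W k) :=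
  (LinearMap.ker (C.d k).toFun).map (C.d k).domain.subtype

/-- The `(k + 1)`-coboundaries: the image of `d k`. -/
def coboundaries (C : HilbertComplex 𝕜 W) (k : ℤ) : Submodule 𝕜 (W (k + 1)) :=
  LinearMap.range (C.d k).toFun

/-- The harmonic space in degree `k + 1`: cocycles orthogonal to all coboundaries. -/
def harmonic (C : HilbertComplex 𝕜 W) (k : ℤ) : Submodule 𝕜 (W (k + 1)) :=
  C.cocycles (k + 1) ⊓ (C.coboundaries k)ᗮ

/-- A Hilbert complex is closed if the image of every differential is closed. -/
def IsClosedComplex (C : HilbertComplex 𝕜 W) : Prop :=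
  ∀ k, IsClosed (C.coboundaries k : Set (W (k + 1)))

/-- The compactness property: in every degree the inclusion of `V ∩ V*` into `W` is compact, where
`V*` is the domain of the adjoint of the incoming differential and `V ∩ V*` carries the norm
`(‖u‖² + ‖d u‖² + ‖d* u‖²)^(1/2)`; that is, the unit ball of `V ∩ V*` is relatively compact. -/
def CompactnessProperty (C : HilbertComplex 𝕜 W) : Prop :=
  ∀ k : ℤ, IsCompact (closure {u : W (k + 1) |
    ∃ (hu : u ∈ (C.d (k + 1)).domain) (hu' : u ∈ (C.d k).adjoint.domain),
      ‖u‖ ^ 2 + ‖C.d (k + 1) ⟨u, hu⟩‖ ^ 2 + ‖(C.d k).adjoint ⟨u, hu'⟩‖ ^ 2 ≤ 1})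

/-- A morphism of Hilbert complexes: bounded maps of the Hilbert spaces that preserve the domains
and commute with the differentials. -/
structure Morphism (C : HilbertComplex 𝕜 W) (C' : HilbertComplex 𝕜 W') where
  toMap : ∀ k : ℤ, W k →L[𝕜] W' k
  map_mem : ∀ k (u : (C.d k).domain), toMap k u ∈ (C'.d k).domain
  comm : ∀ k (u : (C.d k).domain), C'.d k ⟨toMap k u, map_mem k u⟩ = toMap (k + 1) (C.d k u)

/-- `(σ, u, p)` solves the mixed variational problem for the Hodge Laplacian in degree `k + 1`
with right-hand side `f`. -/
def IsMixedSolution (C : HilbertComplex 𝕜 W) (k : ℤ) (f : W (k + 1))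
    (σ : (C.d k).domain) (u : (C.d (k + 1)).domain) (p : C.harmonic k) : Prop :=
  (∀ τ : (C.d k).domain,
    inner 𝕜 (σ : W k) (τ : W k) - inner 𝕜 (u : W (k + 1)) (C.d k τ) = 0) ∧
  (∀ v : (C.d (k + 1)).domain,
    inner 𝕜 (C.d k σ) (v : W (k + 1)) + inner 𝕜 (C.d (k + 1) u) (C.d (k + 1) v)
      + inner 𝕜 (p : W (k + 1)) (v : W (k + 1)) = inner 𝕜 f (v : W (k + 1))) ∧
  (∀ q : C.harmonic k, inner 𝕜 (u : W (k + 1)) (q : W (k + 1)) = 0)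

/-- `K` is the solution operator `f ↦ u` of the mixed problem in degree `k + 1`. The equivalence
says that a solution exists for every `f`, and that its component `u` is unique. -/
def IsSolutionOperator (C : HilbertComplex 𝕜 W) (k : ℤ) (K : W (k + 1) →L[𝕜] W (k + 1)) : Prop :=
  ∀ f u : W (k + 1), K f = u ↔
    ∃ (σ : (C.d k).domain) (hu : u ∈ (C.d (k + 1)).domain) (p : C.harmonic k),
      C.IsMixedSolution k f σ ⟨u, hu⟩ p

/-- `u` is the middle component of a solution `(σ, u, p)` of the Hodge-Laplace eigenvalue problem
in degree `k + 1` with parameter `t`. (If `u = 0`, then `σ = 0` and `p = 0` too.) -/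
def SolvesEigenproblem (C : HilbertComplex 𝕜 W) (k : ℤ) (t : 𝕜) (u : W (k + 1)) : Prop :=
  ∃ (σ : (C.d k).domain) (hu : u ∈ (C.d (k + 1)).domain) (p : C.harmonic k),
    C.IsMixedSolution k (t • u) σ ⟨u, hu⟩ p

/-- `lam 0 ≤ lam 1 ≤ ⋯` (indices `n < N`, where `N` is finite or infinite) are all the eigenvalues
of the Hodge-Laplace eigenvalue problem in degree `k + 1`, repeated according to multiplicity, and
the `u n` with `n < N` are corresponding orthonormal eigenvectors spanning all eigenspaces. -/
structure IsEigensystem (C : HilbertComplex 𝕜 W) (k : ℤ) (N : ℕ∞) (lam : ℕ → ℝ)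
    (u : ℕ → W (k + 1)) : Prop where
  orthonormal : Orthonormal 𝕜 (fun n : {n : ℕ // (n : ℕ∞) < N} => u n)
  monotone : ∀ m n : ℕ, m ≤ n → (n : ℕ∞) < N → lam m ≤ lam n
  solves : ∀ n : ℕ, (n : ℕ∞) < N → C.SolvesEigenproblem k (lam n : 𝕜) (u n)
  complete : ∀ (t : 𝕜) (v : W (k + 1)), C.SolvesEigenproblem k t v →
    v ∈ Submodule.span 𝕜 {w | ∃ n : ℕ, (n : ℕ∞) < N ∧ (lam n : 𝕜) = t ∧ u n = w}

end HilbertComplex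

/-- The gap between two subspaces: the maximum of the suprema, over the unit vectors of either
subspace, of the distance to the other subspace. (The suprema are at most `1`, and `0` for the zero
subspace.) -/
def subspaceGap {𝕜 E : Type*} [RCLike 𝕜] [NormedAddCommGroup E] [InnerProductSpace 𝕜 E]
    (A B : Submodule 𝕜 E) : ℝ :=
  max (⨆ a : {a : E // a ∈ A ∧ ‖a‖ = 1}, Metric.infDist (a : E) (B : Set E))
    (⨆ b : {b : E // b ∈ B ∧ ‖b‖ = 1}, Metric.infDist (b : E) (A : Set E))

/-- `π ∘ P`, where `P` is the orthogonal projection onto the range of `i`. The closure only serves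
to have a closed subspace by construction: if `π ∘ i = id`, then the range of `i` is closed, and
`i ∘ (π ∘ P) = P`. -/
def pulledBackProjection {𝕜 E F : Type*} [RCLike 𝕜]
    [NormedAddCommGroup E] [InnerProductSpace 𝕜 E] [CompleteSpace E]
    [NormedAddCommGroup F] [InnerProductSpace 𝕜 F]
    (i : F →L[𝕜] E) (π : E →L[𝕜] F) : E →L[𝕜] F :=
  π ∘L (LinearMap.range (i : F →ₗ[𝕜] E)).topologicalClosure.starProjection

/-- Convergence of eigenvalue problems, for an exact problem on `E` with eigenvalues `lam n` and
eigenvectors `u n` (`n < N`), and problems on spaces `F h` with eigenvalues `lamh h n` and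
eigenvectors `uh h n` (`n < Nh h`), embedded by `i h : F h → E`.

* For each `n < N`, the `n`-th discrete eigenvalue eventually exists and tends to the exact one.
* If there are only finitely many exact eigenvalues, any further discrete ones tend to infinity.
* If `m` is the number of eigenvalues, with multiplicity, in an initial segment of the distinct
  exact eigenvalues, then the gap between the span of the first `m` exact eigenvectors and the
  image of the span of the first `m` discrete ones tends to zero. -/
structure EigenproblemsConverge {𝕜 ι E : Type*} [RCLike 𝕜] (l : Filter ι)
    [NormedAddCommGroup E] [InnerProductSpace 𝕜 E]
    {F : ι → Type*} [∀ h, NormedAddCommGroup (F h)] [∀ h, InnerProductSpace 𝕜 (F h)]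
    (i : ∀ h, F h →L[𝕜] E)
    (N : ℕ∞) (lam : ℕ → ℝ) (u : ℕ → E)
    (Nh : ι → ℕ∞) (lamh : ι → ℕ → ℝ) (uh : ∀ h, ℕ → F h) : Prop where
  exists_discrete : ∀ n : ℕ, (n : ℕ∞) < N → ∀ᶠ h in l, (n : ℕ∞) < Nh h
  tendsto_eigenvalue : ∀ n : ℕ, (n : ℕ∞) < N → Tendsto (fun h => lamh h n) l (𝓝 (lam n))
  no_spurious : ∀ n : ℕ, N ≤ (n : ℕ∞) → ∀ M : ℝ, ∀ᶠ h in l, (n : ℕ∞) < Nh h → M < lamh h n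
  tendsto_gap : ∀ m : ℕ, (m : ℕ∞) ≤ N →
    (∀ a b : ℕ, a < m → m ≤ b → (b : ℕ∞) < N → lam a < lam b) →
    Tendsto (fun h => subspaceGap
      (Submodule.span 𝕜 {w | ∃ n < m, u n = w})
      ((Submodule.span 𝕜 {w | ∃ n < m, uh h n = w}).map (i h : F h →ₗ[𝕜] E))) l (𝓝 0)

end

/-! The solution operator is `K = T* T + S S*`, where `T` and `S` are the partial (Moore–Penrose)
inverses of `d^k` and `d^{k-1}`. The partial inverse of the discrete differential is obtained by
compressing `π_h T i_h` to the discrete boundaries and the complement of the discrete cycles.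
Compactness of `T` and `S` turns pointwise convergence of uniformly bounded operators into norm
convergence; this gives `‖K - i_h K_h P_h‖ → 0`. The nonzero eigenvalues of the positive compact
operators `K` and `K_h`, which act on different spaces, are then compared by the min–max principle,
and their eigenspaces by estimating `K x - β x` off the span of the leading eigenvectors. The
positive eigenvalues of the mixed problem are the reciprocals of those of `K`, so surplus discrete
eigenvalues of `K_h` tending to `0` correspond to eigenvalues tending to infinity. -/

open ContinuousLinearMap (adjoint)

section UniformlyBounded

variable {𝕜 ι : Type*} [NontriviallyNormedField 𝕜] {l : Filter ι} {E F G : ι → Type*}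
  [∀ h, SeminormedAddCommGroup (E h)] [∀ h, NormedSpace 𝕜 (E h)]
  [∀ h, SeminormedAddCommGroup (F h)] [∀ h, NormedSpace 𝕜 (F h)]
  [∀ h, SeminormedAddCommGroup (G h)] [∀ h, NormedSpace 𝕜 (G h)]

/-- A family of bounded operators, between spaces that may depend on the index, whose norms have a
common bound. -/
def UniformlyBounded (X : ∀ h, E h →L[𝕜] F h) : Prop :=
  ∃ c : ℝ, ∀ h, ‖X h‖ ≤ c

theorem tendsto_norm_add {x y : ∀ h, E h} (hx : Tendsto (fun h => ‖x h‖) l (𝓝 0))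
    (hy : Tendsto (fun h => ‖y h‖) l (𝓝 0)) : Tendsto (fun h => ‖x h + y h‖) l (𝓝 0) :=
  squeeze_zero (fun _ => norm_nonneg _) (fun _ => norm_add_le _ _) (by simpa using hx.add hy)

theorem tendsto_norm_sub {x y : ∀ h, E h} (hx : Tendsto (fun h => ‖x h‖) l (𝓝 0))
    (hy : Tendsto (fun h => ‖y h‖) l (𝓝 0)) : Tendsto (fun h => ‖x h - y h‖) l (𝓝 0) :=
  squeeze_zero (fun _ => norm_nonneg _) (fun _ => norm_sub_le _ _) (by simpa using hx.add hy)

namespace UniformlyBounded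

variable {X : ∀ h, F h →L[𝕜] G h} {Y : ∀ h, E h →L[𝕜] F h}

theorem exists_pos_bound (hX : UniformlyBounded X) : ∃ c : ℝ, 0 < c ∧ ∀ h, ‖X h‖ ≤ c := by
  obtain ⟨c, hc⟩ := hX
  exact ⟨max c 1, by positivity, fun h => (hc h).trans (le_max_left _ _)⟩

protected theorem comp (hX : UniformlyBounded X) (hY : UniformlyBounded Y) :
    UniformlyBounded fun h => X h ∘L Y h := by
  obtain ⟨c, hc0, hc⟩ := hX.exists_pos_bound
  obtain ⟨c', hc'⟩ := hY
  refine ⟨c * c', fun h => ((X h).opNorm_comp_le (Y h)).trans ?_⟩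
  gcongr
  exacts [hc h, hc' h]

protected theorem add {X' : ∀ h, F h →L[𝕜] G h} (hX : UniformlyBounded X)
    (hX' : UniformlyBounded X') : UniformlyBounded fun h => X h + X' h := by
  obtain ⟨c, hc⟩ := hX
  obtain ⟨c', hc'⟩ := hX'
  exact ⟨c + c', fun h => (norm_add_le _ _).trans (add_le_add (hc h) (hc' h))⟩

protected theorem sub {X' : ∀ h, F h →L[𝕜] G h} (hX : UniformlyBounded X)
    (hX' : UniformlyBounded X') : UniformlyBounded fun h => X h - X' h := by
  obtain ⟨c, hc⟩ := hX
  obtain ⟨c', hc'⟩ := hX'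
  exact ⟨c + c', fun h => (norm_sub_le _ _).trans (add_le_add (hc h) (hc' h))⟩

theorem tendsto_norm_apply (hX : UniformlyBounded X) {y : ∀ h, F h}
    (hy : Tendsto (fun h => ‖y h‖) l (𝓝 0)) : Tendsto (fun h => ‖X h (y h)‖) l (𝓝 0) := by
  obtain ⟨c, hc⟩ := hX
  exact squeeze_zero (fun _ => norm_nonneg _) (fun h => (X h).le_of_opNorm_le (hc h) _)
    (by simpa using hy.const_mul c)

theorem tendsto_norm_comp (hX : UniformlyBounded X) (hY : Tendsto (fun h => ‖Y h‖) l (𝓝 0)) :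
    Tendsto (fun h => ‖X h ∘L Y h‖) l (𝓝 0) := by
  obtain ⟨c, hc⟩ := hX
  refine squeeze_zero (fun _ => norm_nonneg _) (fun h => ?_) (by simpa using hY.const_mul c)
  exact ((X h).opNorm_comp_le (Y h)).trans (by gcongr; exact hc h)

theorem tendsto_norm_comp_right (hY : UniformlyBounded Y)
    (hX : Tendsto (fun h => ‖X h‖) l (𝓝 0)) : Tendsto (fun h => ‖X h ∘L Y h‖) l (𝓝 0) := by
  obtain ⟨c, hc⟩ := hY
  refine squeeze_zero (fun _ => norm_nonneg _) (fun h => ?_) (by simpa using hX.mul_const c)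
  exact ((X h).opNorm_comp_le (Y h)).trans (by gcongr; exact hc h)

end UniformlyBounded

theorem tendsto_norm_clm_apply {X : ∀ h, E h →L[𝕜] F h} (hX : Tendsto (fun h => ‖X h‖) l (𝓝 0))
    {y : ∀ h, E h} {c : ℝ} (hy : ∀ h, ‖y h‖ ≤ c) : Tendsto (fun h => ‖X h (y h)‖) l (𝓝 0) :=
  squeeze_zero (fun _ => norm_nonneg _) (fun h => (X h).le_opNorm_of_le (hy h))
    (by simpa using hX.mul_const c)

end UniformlyBounded

section PointwiseConvergence

variable {𝕜 ι E E' : Type*} {l : Filter ι} {F : ι → Type*} [SeminormedAddCommGroup E]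
  [∀ h, SeminormedAddCommGroup (F h)]

section NontriviallyNormedField

variable [NontriviallyNormedField 𝕜] [NormedSpace 𝕜 E] [∀ h, NormedSpace 𝕜 (F h)]

protected theorem UniformlyBounded.const [SeminormedAddCommGroup E'] [NormedSpace 𝕜 E']
    (A : E →L[𝕜] E') : UniformlyBounded fun _ : ι => A :=
  ⟨‖A‖, fun _ => le_rfl⟩

theorem norm_apply_le_mul_norm_sub_add [SeminormedAddCommGroup E'] [NormedSpace 𝕜 E']
    {A : E →L[𝕜] E'} {c : ℝ} (hA : ‖A‖ ≤ c) (x y : E) : ‖A x‖ ≤ c * ‖x - y‖ + ‖A y‖ :=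
  calc ‖A x‖ = ‖A (x - y) + A y‖ := by rw [← map_add, sub_add_cancel]
    _ ≤ c * ‖x - y‖ + ‖A y‖ :=
      (norm_add_le _ _).trans (add_le_add_left (A.le_of_opNorm_le hA _) _)

variable {X : ∀ h, E →L[𝕜] F h}

theorem UniformlyBounded.eventually_forall_norm_apply_lt (hX : UniformlyBounded X) {Q : Set E}
    (hQ : TotallyBounded Q) (hlim : ∀ x ∈ Q, Tendsto (fun h => ‖X h x‖) l (𝓝 0)) {ε : ℝ}
    (hε : 0 < ε) : ∀ᶠ h in l, ∀ x ∈ Q, ‖X h x‖ < ε := by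
  obtain ⟨c, hc0, hc⟩ := hX.exists_pos_bound
  obtain ⟨t, htQ, htfin, hcov⟩ :=
    Metric.finite_approx_of_totallyBounded hQ (ε / 2 / c) (by positivity)
  have hnet : ∀ᶠ h in l, ∀ y ∈ t, ‖X h y‖ < ε / 2 :=
    (eventually_all_finite htfin).2 fun y hy =>
      (hlim y (htQ hy)).eventually_lt_const (half_pos hε)
  filter_upwards [hnet] with h hh x hx
  obtain ⟨y, hy, hxy⟩ := Set.mem_iUnion₂.1 (hcov hx)
  rw [Metric.mem_ball, dist_eq_norm, lt_div_iff₀' hc0] at hxy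
  linarith [norm_apply_le_mul_norm_sub_add (hc h) x y, hh y hy]

theorem UniformlyBounded.tendsto_norm_apply_of_dense (hX : UniformlyBounded X) {S : Set E}
    (hS : Dense S) (hlim : ∀ v ∈ S, Tendsto (fun h => ‖X h v‖) l (𝓝 0)) (x : E) :
    Tendsto (fun h => ‖X h x‖) l (𝓝 0) := by
  obtain ⟨c, hc0, hc⟩ := hX.exists_pos_bound
  refine Metric.tendsto_nhds.2 fun ε hε => ?_
  obtain ⟨v, hv, hxv⟩ := Metric.mem_closure_iff.1 (hS x) (ε / 2 / c) (by positivity)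
  filter_upwards [(hlim v hv).eventually_lt_const (half_pos hε)] with h hh
  rw [dist_eq_norm, lt_div_iff₀' hc0] at hxv
  rw [dist_zero_right, norm_norm]
  linarith [norm_apply_le_mul_norm_sub_add (hc h) x v]

end NontriviallyNormedField

variable [RCLike 𝕜] [NormedSpace 𝕜 E] [∀ h, NormedSpace 𝕜 (F h)]

theorem UniformlyBounded.tendsto_norm_comp_isCompactOperator {X : ∀ h, E →L[𝕜] F h}
    (hX : UniformlyBounded X) [NormedAddCommGroup E'] [NormedSpace 𝕜 E']
    {A : E' →L[𝕜] E} (hA : IsCompactOperator A)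
    (hlim : ∀ x, Tendsto (fun h => ‖X h (A x)‖) l (𝓝 0)) :
    Tendsto (fun h => ‖X h ∘L A‖) l (𝓝 0) := by
  have hball : TotallyBounded (A '' Metric.closedBall 0 1) := by
    obtain ⟨Q, hQ, hsub⟩ := hA.image_closedBall_subset_compact (f := (A : E' →ₗ[𝕜] E)) 1
    exact hQ.totallyBounded.subset hsub
  refine Metric.tendsto_nhds.2 fun ε hε => ?_
  filter_upwards [hX.eventually_forall_norm_apply_lt hball
    (Set.forall_mem_image.2 fun x _ => hlim x) (half_pos hε)] with h hh
  rw [dist_zero_right, norm_norm]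
  refine (ContinuousLinearMap.opNorm_le_of_unit_norm (half_pos hε).le fun x hx => ?_).trans_lt
    (half_lt_self hε)
  exact (hh _ (Set.mem_image_of_mem A (mem_closedBall_zero_iff.2 hx.le))).le

end PointwiseConvergence

section Adjoint

variable {𝕜 ι : Type*} [RCLike 𝕜] {l : Filter ι} {F : ι → Type*}
  [∀ h, NormedAddCommGroup (F h)] [∀ h, InnerProductSpace 𝕜 (F h)]

protected theorem UniformlyBounded.starProjection (S : ∀ h, Submodule 𝕜 (F h))
    [∀ h, (S h).HasOrthogonalProjection] : UniformlyBounded fun h => (S h).starProjection :=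
  ⟨1, fun h => (S h).starProjection_norm_le⟩

variable [∀ h, CompleteSpace (F h)]

protected theorem UniformlyBounded.adjoint {E : ι → Type*} [∀ h, NormedAddCommGroup (E h)]
    [∀ h, InnerProductSpace 𝕜 (E h)] [∀ h, CompleteSpace (E h)] {X : ∀ h, F h →L[𝕜] E h}
    (hX : UniformlyBounded X) : UniformlyBounded fun h => adjoint (X h) := by
  obtain ⟨c, hc⟩ := hX
  exact ⟨c, fun h => (LinearIsometryEquiv.norm_map _ _).trans_le (hc h)⟩

-- The identity `‖A X‖² = ‖X* (A* A X)‖` avoids Schauder's theorem on the compactness of `A*`.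
theorem UniformlyBounded.tendsto_norm_isCompactOperator_comp {E E' : Type*} [NormedAddCommGroup E]
    [InnerProductSpace 𝕜 E] [CompleteSpace E] [NormedAddCommGroup E'] [InnerProductSpace 𝕜 E']
    [CompleteSpace E'] {X : ∀ h, F h →L[𝕜] E} (hX : UniformlyBounded X) {A : E →L[𝕜] E'}
    (hA : IsCompactOperator A)
    (hlim : ∀ x, Tendsto (fun h => ‖adjoint (X h) (adjoint A x)‖) l (𝓝 0)) :
    Tendsto (fun h => ‖A ∘L X h‖) l (𝓝 0) := by
  have hleft : Tendsto (fun h => ‖adjoint (X h) ∘L (adjoint A ∘L A)‖) l (𝓝 0) :=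
    hX.adjoint.tendsto_norm_comp_isCompactOperator (A := adjoint A ∘L A)
      (hA.clm_comp (adjoint A)) fun x => hlim (A x)
  have hsq : Tendsto (fun h => ‖A ∘L X h‖ ^ 2) l (𝓝 0) := by
    refine (hX.tendsto_norm_comp_right hleft).congr fun h => ?_
    rw [sq, ← ContinuousLinearMap.norm_adjoint_comp_self, ContinuousLinearMap.adjoint_comp]
    rfl
  simpa using hsq.sqrt

end Adjoint

section PositiveOperator

variable {𝕜 E : Type*} [RCLike 𝕜] [NormedAddCommGroup E] [InnerProductSpace 𝕜 E]

theorem re_inner_apply_le_norm_mul (K : E →L[𝕜] E) (x : E) :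
    RCLike.re (inner 𝕜 (K x) x) ≤ ‖K‖ * ‖x‖ ^ 2 :=
  calc RCLike.re (inner 𝕜 (K x) x) ≤ ‖K x‖ * ‖x‖ := re_inner_le_norm _ _
    _ ≤ ‖K‖ * ‖x‖ * ‖x‖ := by gcongr; exact K.le_opNorm x
    _ = ‖K‖ * ‖x‖ ^ 2 := by ring

theorem apply_mem_orthogonal_of_invariant {K : E →L[𝕜] E} (hK : K.IsPositive) {S : Submodule 𝕜 E}
    (hS : ∀ x ∈ S, K x ∈ S) {x : E} (hx : x ∈ Sᗮ) : K x ∈ Sᗮ := fun y hy => by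
  rw [← hK.inner_left_eq_inner_right]
  exact hx _ (hS y hy)

theorem inner_eq_zero_of_eigenvalue_ne {K : E →L[𝕜] E} (hK : K.IsPositive) {s t : ℝ} {v w : E}
    (hv : K v = (s : 𝕜) • v) (hw : K w = (t : 𝕜) • w) (hst : s ≠ t) : inner 𝕜 v w = 0 :=
  hK.isSymmetric.orthogonalFamily_eigenspaces (RCLike.ofReal_injective.ne hst)
    ⟨v, Module.End.mem_eigenspace_iff.2 hv⟩ ⟨w, Module.End.mem_eigenspace_iff.2 hw⟩

theorem norm_sub_sq_of_orthonormal {α : Type*} {u : α → E} (hu : Orthonormal 𝕜 u) {a b : α}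
    (hab : a ≠ b) : ‖u a - u b‖ ^ 2 = 2 := by
  rw [norm_sub_sq (𝕜 := 𝕜), hu.2 hab, hu.1, hu.1, map_zero]
  norm_num

theorem not_forall_orthonormal_mem_of_isCompact {u : ℕ → E} (hu : Orthonormal 𝕜 u) {Q : Set E}
    (hQ : IsCompact Q) : ¬ ∀ n, u n ∈ Q := fun hmem => by
  obtain ⟨a, -, φ, hφ, hlim⟩ := hQ.tendsto_subseq hmem
  obtain ⟨M, hM⟩ := Metric.cauchySeq_iff'.1 hlim.cauchySeq 1 one_pos
  have hdist := hM (M + 1) (Nat.le_succ M)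
  have hsq := norm_sub_sq_of_orthonormal hu (hφ (Nat.lt_succ_self M)).ne'
  rw [dist_eq_norm, Function.comp_apply, Function.comp_apply] at hdist
  nlinarith [norm_nonneg (u (φ (M + 1)) - u (φ M))]

theorem not_forall_le_eigenvalue_of_orthonormal {K : E →L[𝕜] E} (hK : IsCompactOperator K)
    {u : ℕ → E} (hu : Orthonormal 𝕜 u) {μ : ℕ → ℝ} (h : ∀ n, K (u n) = (μ n : 𝕜) • u n)
    {t : ℝ} (ht : 0 < t) : ¬ ∀ n, t ≤ μ n := fun hle => by
  obtain ⟨Q, hQ, hsub⟩ := hK.image_closedBall_subset_compact (f := (K : E →ₗ[𝕜] E)) t⁻¹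
  refine not_forall_orthonormal_mem_of_isCompact hu hQ fun n => ?_
  have hμ : 0 < μ n := ht.trans_le (hle n)
  refine hsub ⟨(((μ n)⁻¹ : ℝ) : 𝕜) • u n, ?_, ?_⟩
  · rw [mem_closedBall_zero_iff, norm_smul, hu.1 n, mul_one, RCLike.norm_ofReal,
      abs_of_pos (inv_pos.2 hμ)]
    exact inv_anti₀ ht (hle n)
  · rw [ContinuousLinearMap.coe_coe, map_smul, h n, smul_smul, ← RCLike.ofReal_mul,
      inv_mul_cancel₀ hμ.ne', RCLike.ofReal_one, one_smul]

theorem exists_norm_eigenvector [CompleteSpace E] {K : E →L[𝕜] E} (hK : IsCompactOperator K)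
    (hpos : K.IsPositive) (h0 : K ≠ 0) : ∃ w : E, ‖w‖ = 1 ∧ K w = (‖K‖ : 𝕜) • w := by
  have : Nontrivial E := by
    by_contra h
    rw [not_nontrivial_iff_subsingleton] at h
    exact h0 (Subsingleton.elim _ _)
  have hspectrum : algebraMap ℝ 𝕜 ‖K‖ ∈ spectrum 𝕜 K := fun h => by
    obtain ⟨c, hc0, hc⟩ := K.rayleighQuotient_le_of_norm_mem_resolventSet h
    have hle : ∀ x, |K.rayleighQuotient x| ≤ ‖K‖ - c := fun x => by
      rw [abs_of_nonneg (div_nonneg (hpos.2 x) (by positivity))]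
      exact hc x
    have := K.norm_eq_iSup_rayleighQuotient hpos.isSymmetric ▸ ciSup_le hle
    linarith
  obtain ⟨v, hv⟩ :=
    ((hK.hasEigenvalue_iff_mem_spectrum (by simpa using h0)).2 hspectrum).exists_hasEigenvector
  have hKv : K v = (‖K‖ : 𝕜) • v := hv.apply_eq_smul
  refine ⟨(‖v‖ : 𝕜)⁻¹ • v, norm_smul_inv_norm hv.2, ?_⟩
  rw [map_smul, hKv, smul_comm]

end PositiveOperator

section Compression

variable {𝕜 E : Type*} [RCLike 𝕜] [NormedAddCommGroup E] [InnerProductSpace 𝕜 E] [CompleteSpace E]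
  {K : E →L[𝕜] E} {S : Submodule 𝕜 E}

/-- The compression of an operator to the orthogonal complement of `S`, extended by zero to `S`. -/
noncomputable def compression (K : E →L[𝕜] E) (S : Submodule 𝕜 E) : E →L[𝕜] E :=
  Sᗮ.starProjection ∘L K ∘L Sᗮ.starProjection

theorem isCompactOperator_compression (hK : IsCompactOperator K) (S : Submodule 𝕜 E) :
    IsCompactOperator (compression K S) :=
  (hK.comp_clm Sᗮ.starProjection).clm_comp Sᗮ.starProjection

theorem isPositive_compression (hK : K.IsPositive) (S : Submodule 𝕜 E) :
    (compression K S).IsPositive :=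
  hK.conj_starProjection _

theorem compression_apply_of_mem_orthogonal (hK : K.IsPositive) (hS : ∀ x ∈ S, K x ∈ S) {x : E}
    (hx : x ∈ Sᗮ) : compression K S x = K x := by
  simp only [compression, ContinuousLinearMap.comp_apply]
  rw [Submodule.starProjection_eq_self_iff.2 hx,
    Submodule.starProjection_eq_self_iff.2 (apply_mem_orthogonal_of_invariant hK hS hx)]

theorem compression_compression_of_le (K : E →L[𝕜] E) {S' : Submodule 𝕜 E} (h : S ≤ S') :
    compression (compression K S) S' = compression K S' := by
  have h' : S'ᗮ ≤ Sᗮ := Submodule.orthogonal_le h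
  ext x
  have hright : Sᗮ.starProjection (S'ᗮ.starProjection x) = S'ᗮ.starProjection x :=
    Submodule.starProjection_eq_self_iff.2 (h' (Submodule.starProjection_apply_mem _ _))
  have hleft : ∀ y, S'ᗮ.starProjection (Sᗮ.starProjection y) = S'ᗮ.starProjection y := fun y =>
    congrArg (fun f : E →L[𝕜] E => f y) (Submodule.starProjection_comp_starProjection_of_le h')
  simp only [compression, ContinuousLinearMap.comp_apply, hright, hleft]

theorem norm_compression_le (K : E →L[𝕜] E) (S : Submodule 𝕜 E) : ‖compression K S‖ ≤ ‖K‖ := by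
  have hP := Sᗮ.starProjection_norm_le
  calc ‖compression K S‖ ≤ ‖Sᗮ.starProjection‖ * (‖K‖ * ‖Sᗮ.starProjection‖) :=
        (ContinuousLinearMap.opNorm_comp_le _ _).trans
          (by gcongr; exact ContinuousLinearMap.opNorm_comp_le _ _)
    _ ≤ 1 * (‖K‖ * 1) := by gcongr
    _ = ‖K‖ := by ring

theorem norm_compression_antitone (K : E →L[𝕜] E) :
    Antitone fun S : Submodule 𝕜 E => ‖compression K S‖ := fun S S' h => by
  simpa only [compression_compression_of_le K h] using norm_compression_le (compression K S) S'

theorem exists_eigenvector_compression (hK : IsCompactOperator K) (hpos : K.IsPositive)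
    (hS : ∀ x ∈ S, K x ∈ S) (h0 : compression K S ≠ 0) :
    ∃ w ∈ Sᗮ, ‖w‖ = 1 ∧ K w = (‖compression K S‖ : 𝕜) • w := by
  obtain ⟨w, hw1, hw⟩ := exists_norm_eigenvector (isCompactOperator_compression hK S)
    (isPositive_compression hpos S) h0
  have hmem : w ∈ Sᗮ := by
    refine (Submodule.smul_mem_iff _ (s := (‖compression K S‖ : 𝕜)) (by simpa using h0)).1 ?_
    rw [← hw]
    exact Submodule.starProjection_apply_mem _ _
  exact ⟨w, hmem, hw1, by rw [← hw, compression_apply_of_mem_orthogonal hpos hS hmem]⟩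

open Classical in
/-- A unit eigenvector of `K` in the orthogonal complement of `S`, with eigenvalue the norm of the
compression of `K`; zero if there is none. -/
noncomputable def topEigenvector (K : E →L[𝕜] E) (S : Submodule 𝕜 E) : E :=
  if h : ∃ w ∈ Sᗮ, ‖w‖ = 1 ∧ K w = (‖compression K S‖ : 𝕜) • w then h.choose else 0

theorem topEigenvector_mem_orthogonal (K : E →L[𝕜] E) (S : Submodule 𝕜 E) :
    topEigenvector K S ∈ Sᗮ := by
  unfold topEigenvector
  split_ifs with h
  exacts [h.choose_spec.1, zero_mem _]

theorem apply_topEigenvector (K : E →L[𝕜] E) (S : Submodule 𝕜 E) :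
    K (topEigenvector K S) = (‖compression K S‖ : 𝕜) • topEigenvector K S := by
  unfold topEigenvector
  split_ifs with h
  exacts [h.choose_spec.2.2, by simp]

theorem norm_topEigenvector (hK : IsCompactOperator K) (hpos : K.IsPositive)
    (hS : ∀ x ∈ S, K x ∈ S) (h0 : compression K S ≠ 0) : ‖topEigenvector K S‖ = 1 := by
  have h := exists_eigenvector_compression hK hpos hS h0
  rw [topEigenvector, dif_pos h]
  exact h.choose_spec.2.1

end Compression

section Deflation

variable {𝕜 E : Type*} [RCLike 𝕜] [NormedAddCommGroup E] [InnerProductSpace 𝕜 E] [CompleteSpace E]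

/-- The span of the first `n` eigenvectors found by successively maximizing the Rayleigh quotient
of `K` on the orthogonal complement of those found before. -/
noncomputable def deflation (K : E →L[𝕜] E) : ℕ → Submodule 𝕜 E
  | 0 => ⊥
  | n + 1 => deflation K n ⊔ Submodule.span 𝕜 {topEigenvector K (deflation K n)}

variable {K : E →L[𝕜] E}

theorem deflation_mono (K : E →L[𝕜] E) : Monotone (deflation K) :=
  monotone_nat_of_le_succ fun _ => le_sup_left

theorem apply_mem_deflation (K : E →L[𝕜] E) (n : ℕ) : ∀ x ∈ deflation K n, K x ∈ deflation K n := by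
  induction n with
  | zero =>
    intro x hx
    rw [(Submodule.mem_bot 𝕜).1 hx, map_zero]
    exact zero_mem _
  | succ n ih =>
    suffices deflation K (n + 1) ≤ (deflation K (n + 1)).comap (K : E →ₗ[𝕜] E) from this
    refine sup_le (fun x hx => deflation_mono K n.le_succ (ih x hx)) ?_
    rw [Submodule.span_singleton_le_iff_mem, Submodule.mem_comap, ContinuousLinearMap.coe_coe,
      apply_topEigenvector]
    exact Submodule.smul_mem _ _ (Submodule.mem_sup_right (Submodule.mem_span_singleton_self _))

theorem topEigenvector_mem_deflation (K : E →L[𝕜] E) {m n : ℕ} (h : m < n) :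
    topEigenvector K (deflation K m) ∈ deflation K n :=
  deflation_mono K h (Submodule.mem_sup_right (Submodule.mem_span_singleton_self _))

theorem inner_topEigenvector_deflation (K : E →L[𝕜] E) {m n : ℕ} (h : m ≠ n) :
    inner 𝕜 (topEigenvector K (deflation K m)) (topEigenvector K (deflation K n)) = 0 := by
  rcases h.lt_or_gt with hmn | hnm
  · exact topEigenvector_mem_orthogonal K _ _ (topEigenvector_mem_deflation K hmn)
  · exact inner_eq_zero_symm.1
      (topEigenvector_mem_orthogonal K _ _ (topEigenvector_mem_deflation K hnm))

theorem orthonormal_topEigenvector_deflation (hK : IsCompactOperator K) (hpos : K.IsPositive)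
    {α : Type*} {f : α → ℕ} (hf : Function.Injective f)
    (h0 : ∀ a, compression K (deflation K (f a)) ≠ 0) :
    Orthonormal 𝕜 fun a => topEigenvector K (deflation K (f a)) :=
  ⟨fun a => norm_topEigenvector hK hpos (apply_mem_deflation K _) (h0 a),
    fun _ _ hab => inner_topEigenvector_deflation K (hf.ne hab)⟩

theorem mem_deflation_orthogonal {v : E}
    (hv : ∀ n, inner 𝕜 (topEigenvector K (deflation K n)) v = 0) (n : ℕ) :
    v ∈ (deflation K n)ᗮ := by
  induction n with
  | zero => simp [deflation]
  | succ n ih =>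
    rw [deflation, ← Submodule.inf_orthogonal]
    exact ⟨ih, Submodule.mem_orthogonal_singleton_iff_inner_right.2 (hv n)⟩

theorem eigenvalue_le_norm_compression (hpos : K.IsPositive) {S : Submodule 𝕜 E}
    (hS : ∀ x ∈ S, K x ∈ S) {t : ℝ} {v : E} (hv : K v = (t : 𝕜) • v) (hv0 : v ≠ 0)
    (hvS : v ∈ Sᗮ) : t ≤ ‖compression K S‖ := by
  have h := (compression K S).le_opNorm v
  rw [compression_apply_of_mem_orthogonal hpos hS hvS, hv, norm_smul, RCLike.norm_ofReal] at h
  exact (le_abs_self t).trans (le_of_mul_le_mul_right h (norm_pos_iff.2 hv0))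

-- Otherwise the norms of all the compressions are at least the eigenvalue of `v`.
theorem eq_zero_of_forall_inner_topEigenvector_eq_zero (hK : IsCompactOperator K)
    (hpos : K.IsPositive) {t : ℝ} (ht : 0 < t) {v : E} (hv : K v = (t : 𝕜) • v)
    (horth : ∀ n, inner 𝕜 (topEigenvector K (deflation K n)) v = 0) : v = 0 := by
  by_contra hv0
  have hle : ∀ n, t ≤ ‖compression K (deflation K n)‖ := fun n =>
    eigenvalue_le_norm_compression hpos (apply_mem_deflation K n) hv hv0
      (mem_deflation_orthogonal horth n)
  exact not_forall_le_eigenvalue_of_orthonormal hK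
    (orthonormal_topEigenvector_deflation hK hpos Function.injective_id fun n =>
      norm_pos_iff.1 (ht.trans_le (hle n)))
    (fun n => apply_topEigenvector K (deflation K n)) ht hle

end Deflation

section SpectralSystem

variable {𝕜 E : Type*} [RCLike 𝕜] [NormedAddCommGroup E] [InnerProductSpace 𝕜 E]

/-- The nonzero eigenvalues of a positive compact operator in nonincreasing order, repeated
according to multiplicity and continued by zero, with orthonormal eigenvectors. The values `u n`
for `n ≥ N` are irrelevant. -/
structure IsSpectralSystem (K : E →L[𝕜] E) (N : ℕ∞) (μ : ℕ → ℝ) (u : ℕ → E) : Prop where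
  orthonormal : Orthonormal 𝕜 (fun n : {n : ℕ // (n : ℕ∞) < N} => u n)
  antitone : Antitone μ
  pos : ∀ n : ℕ, (n : ℕ∞) < N → 0 < μ n
  eq_zero : ∀ n : ℕ, N ≤ (n : ℕ∞) → μ n = 0
  apply_eq : ∀ n : ℕ, (n : ℕ∞) < N → K (u n) = (μ n : 𝕜) • u n
  mem_span : ∀ (t : ℝ) (v : E), 0 < t → K v = (t : 𝕜) • v →
    v ∈ Submodule.span 𝕜 {w | ∃ n : ℕ, (n : ℕ∞) < N ∧ μ n = t ∧ u n = w}

theorem exists_enat_forall_lt_iff {p : ℕ → Prop} (hp : Antitone p) :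
    ∃ N : ℕ∞, ∀ n : ℕ, (n : ℕ∞) < N ↔ p n := by
  classical
  by_cases h : ∃ n, ¬ p n
  · refine ⟨(Nat.find h : ℕ), fun n => Nat.cast_lt.trans
      ⟨fun hn => not_not.1 (Nat.find_min h hn), fun hn => ?_⟩⟩
    by_contra hlt
    exact Nat.find_spec h (hp (not_lt.1 hlt) hn)
  · push Not at h
    exact ⟨⊤, fun n => ⟨fun _ => h n, fun _ => ENat.natCast_lt_top n⟩⟩

theorem mem_span_topEigenvector_deflation [CompleteSpace E] {K : E →L[𝕜] E}
    (hK : IsCompactOperator K) (hpos : K.IsPositive) {t : ℝ} (ht : 0 < t) {v : E}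
    (hv : K v = (t : 𝕜) • v) :
    v ∈ Submodule.span 𝕜 {w | ∃ n, ‖compression K (deflation K n)‖ = t ∧
      topEigenvector K (deflation K n) = w} := by
  set T := Submodule.span 𝕜 {w | ∃ n, ‖compression K (deflation K n)‖ = t ∧
    topEigenvector K (deflation K n) = w} with hT
  have hTK : T ≤ Module.End.eigenspace (K : E →ₗ[𝕜] E) (t : 𝕜) := by
    rw [hT, Submodule.span_le]
    rintro _ ⟨n, rfl, rfl⟩
    exact Module.End.mem_eigenspace_iff.2 (apply_topEigenvector K _)
  have : FiniteDimensional 𝕜 (Module.End.eigenspace (K : E →ₗ[𝕜] E) (t : 𝕜)) :=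
    ContinuousLinearMap.finite_dimensional_eigenspace hK _ (by exact_mod_cast ht.ne')
  have : FiniteDimensional 𝕜 T := Submodule.finiteDimensional_of_le hTK
  have hvT : v - T.starProjection v ∈ Tᗮ := T.sub_starProjection_mem_orthogonal v
  have hKv : K (v - T.starProjection v) = (t : 𝕜) • (v - T.starProjection v) :=
    Module.End.mem_eigenspace_iff.1 (sub_mem (Module.End.mem_eigenspace_iff.2 hv)
      (hTK (T.starProjection_apply_mem v)))
  have horth : ∀ n, inner 𝕜 (topEigenvector K (deflation K n)) (v - T.starProjection v) = 0 := by
    intro n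
    by_cases hn : ‖compression K (deflation K n)‖ = t
    · exact hvT _ (Submodule.subset_span ⟨n, hn, rfl⟩)
    · exact inner_eq_zero_of_eigenvalue_ne hpos (apply_topEigenvector K _) hKv hn
  rw [sub_eq_zero.1 (eq_zero_of_forall_inner_topEigenvector_eq_zero hK hpos ht hKv horth)]
  exact T.starProjection_apply_mem v

theorem exists_isSpectralSystem [CompleteSpace E] {K : E →L[𝕜] E} (hK : IsCompactOperator K)
    (hpos : K.IsPositive) : ∃ N μ u, IsSpectralSystem (𝕜 := 𝕜) K N μ u := by
  have hanti : Antitone fun n => ‖compression K (deflation K n)‖ :=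
    (norm_compression_antitone K).comp_monotone (deflation_mono K)
  obtain ⟨N, hN⟩ := exists_enat_forall_lt_iff
    (p := fun n => 0 < ‖compression K (deflation K n)‖) fun _ _ hmn h => h.trans_le (hanti hmn)
  exact ⟨N, fun n => ‖compression K (deflation K n)‖, fun n => topEigenvector K (deflation K n),
    { orthonormal := orthonormal_topEigenvector_deflation hK hpos Subtype.val_injective
        fun n => norm_pos_iff.1 ((hN n).1 n.2)
      antitone := hanti
      pos := fun n => (hN n).1
      eq_zero := fun n hn => by_contra fun h =>
        hn.not_gt ((hN n).2 ((norm_nonneg _).lt_of_ne' h))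
      apply_eq := fun n _ => apply_topEigenvector K _
      mem_span := fun t v ht hv => by
        refine Submodule.span_mono ?_ (mem_span_topEigenvector_deflation hK hpos ht hv)
        rintro w ⟨n, hn, hw⟩
        exact ⟨n, (hN n).2 (hn ▸ ht), hn, hw⟩ }⟩

end SpectralSystem

section Rayleigh

variable {𝕜 E F : Type*} [RCLike 𝕜] [NormedAddCommGroup E] [InnerProductSpace 𝕜 E]
  [NormedAddCommGroup F] [InnerProductSpace 𝕜 F]

theorem mul_norm_sq_le_re_inner_of_mem_span {A : E →L[𝕜] E} {α : Type*} [Finite α] {v : α → E}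
    (hv : Orthonormal 𝕜 v) {μ : α → ℝ} (hA : ∀ a, A (v a) = (μ a : 𝕜) • v a) {t : ℝ}
    (ht : ∀ a, t ≤ μ a) {x : E} (hx : x ∈ Submodule.span 𝕜 (Set.range v)) :
    t * ‖x‖ ^ 2 ≤ RCLike.re (inner 𝕜 (A x) x) := by
  cases nonempty_fintype α
  obtain ⟨c, rfl⟩ := (Submodule.mem_span_range_iff_exists_fun 𝕜).1 hx
  have hAx : A (∑ a, c a • v a) = ∑ a, ((μ a : 𝕜) * c a) • v a := by
    rw [map_sum]
    exact Finset.sum_congr rfl fun a _ => by rw [map_smul, hA, smul_smul, mul_comm]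
  rw [hAx, norm_sq_eq_re_inner (𝕜 := 𝕜), hv.inner_sum, hv.inner_sum, map_sum, map_sum,
    Finset.mul_sum]
  refine Finset.sum_le_sum fun a _ => ?_
  rw [map_mul (starRingEnd 𝕜), RCLike.conj_ofReal, mul_assoc, RCLike.re_ofReal_mul,
    RCLike.conj_mul, ← RCLike.ofReal_pow, RCLike.ofReal_re]
  exact mul_le_mul_of_nonneg_right (ht a) (sq_nonneg _)

theorem exists_mem_ne_zero_apply_mem_orthogonal (j : F →ₗ[𝕜] E) {S : Submodule 𝕜 E}
    [FiniteDimensional 𝕜 S] {T : Submodule 𝕜 F} [FiniteDimensional 𝕜 T]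
    (h : Module.finrank 𝕜 S < Module.finrank 𝕜 T) : ∃ x ∈ T, x ≠ 0 ∧ j x ∈ Sᗮ := by
  let L : T →ₗ[𝕜] S := (S.orthogonalProjectionOnto : E →ₗ[𝕜] S) ∘ₗ j ∘ₗ T.subtype
  obtain ⟨x, hx, hx0⟩ := (Submodule.ne_bot_iff _).1 (L.ker_ne_bot_of_finrank_lt h)
  exact ⟨x, x.2, fun h0 => hx0 (Subtype.ext h0),
    Submodule.orthogonalProjectionOnto_eq_zero_iff.1 hx⟩

theorem re_inner_apply_le_re_inner_add_norm_mul [CompleteSpace E] [CompleteSpace F]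
    (A : E →L[𝕜] E) (B : F →L[𝕜] F) (j : F →L[𝕜] E) (x : F) :
    RCLike.re (inner 𝕜 (B x) x)
      ≤ RCLike.re (inner 𝕜 (A (j x)) (j x)) + ‖adjoint j ∘L A ∘L j - B‖ * ‖x‖ ^ 2 := by
  have hsplit : RCLike.re (inner 𝕜 (B x) x) = RCLike.re (inner 𝕜 (A (j x)) (j x))
      + RCLike.re (inner 𝕜 ((B - adjoint j ∘L A ∘L j) x) x) := by
    simp only [sub_apply, ContinuousLinearMap.comp_apply, inner_sub_left,
      ContinuousLinearMap.adjoint_inner_left, map_sub]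
    ring
  rw [hsplit, norm_sub_rev]
  gcongr
  exact re_inner_apply_le_norm_mul _ x

-- Test `A y - β y` with the component of `y` orthogonal to `S`.
theorem mul_norm_sub_starProjection_le {A : E →L[𝕜] E} {S : Submodule 𝕜 E}
    [S.HasOrthogonalProjection] (hS : ∀ x ∈ S, A x ∈ S) {t : ℝ}
    (ht : ∀ x ∈ Sᗮ, RCLike.re (inner 𝕜 (A x) x) ≤ t * ‖x‖ ^ 2) (β : ℝ) (y : E) :
    (β - t) * ‖y - S.starProjection y‖ ≤ ‖A y - (β : 𝕜) • y‖ := by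
  set w := y - S.starProjection y with hw
  have hwS : w ∈ Sᗮ := S.sub_starProjection_mem_orthogonal y
  have hyS : y - w ∈ S := by
    rw [hw, sub_sub_cancel]
    exact S.starProjection_apply_mem y
  have hinner : inner 𝕜 (A y - (β : 𝕜) • y) w = inner 𝕜 (A w - (β : 𝕜) • w) w := by
    rw [← sub_eq_zero, ← inner_sub_left, sub_sub_sub_comm, ← map_sub, ← smul_sub]
    exact hwS _ (S.sub_mem (hS _ hyS) (S.smul_mem _ hyS))
  have hle : β * ‖w‖ ^ 2 - RCLike.re (inner 𝕜 (A w) w) ≤ ‖A y - (β : 𝕜) • y‖ * ‖w‖ :=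
    calc β * ‖w‖ ^ 2 - RCLike.re (inner 𝕜 (A w) w)
        = -RCLike.re (inner 𝕜 (A y - (β : 𝕜) • y) w) := by
          rw [hinner, inner_sub_left, inner_smul_left, RCLike.conj_ofReal,
            map_sub (RCLike.re : 𝕜 →+ ℝ), RCLike.re_ofReal_mul, ← norm_sq_eq_re_inner, neg_sub]
      _ ≤ ‖inner 𝕜 (A y - (β : 𝕜) • y) w‖ := (neg_le_abs _).trans (RCLike.abs_re_le_norm _)
      _ ≤ ‖A y - (β : 𝕜) • y‖ * ‖w‖ := norm_inner_le_norm _ _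
  rcases (norm_nonneg w).eq_or_lt with h0 | h0
  · rw [← h0, mul_zero]
    exact norm_nonneg _
  · refine le_of_mul_le_mul_right ?_ h0
    linarith [ht w hwS]

end Rayleigh

section MinMax

variable {𝕜 E F : Type*} [RCLike 𝕜] [NormedAddCommGroup E] [InnerProductSpace 𝕜 E]
  [NormedAddCommGroup F] [InnerProductSpace 𝕜 F]

/-- The span of those `u n` with `n < m` and `n < N`: for a spectral system, the span of the
eigenvectors for the `m` largest eigenvalues. -/
def initialSpan (𝕜 : Type*) {E : Type*} [RCLike 𝕜] [NormedAddCommGroup E] [InnerProductSpace 𝕜 E]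
    (N : ℕ∞) (u : ℕ → E) (m : ℕ) : Submodule 𝕜 E :=
  Submodule.span 𝕜 {w | ∃ n < m, (n : ℕ∞) < N ∧ u n = w}

theorem initialSpan_le_span_range (N : ℕ∞) (u : ℕ → E) (m : ℕ) :
    initialSpan 𝕜 N u m ≤ Submodule.span 𝕜 (Set.range fun a : Fin m => u a) :=
  Submodule.span_mono fun _ ⟨n, hnm, _, hw⟩ => ⟨⟨n, hnm⟩, hw⟩

theorem initialSpan_eq_span_range {N : ℕ∞} (u : ℕ → E) {m : ℕ} (hm : (m : ℕ∞) ≤ N) :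
    initialSpan 𝕜 N u m = Submodule.span 𝕜 (Set.range fun a : Fin m => u a) := by
  refine (initialSpan_le_span_range N u m).antisymm (Submodule.span_mono ?_)
  rintro _ ⟨a, rfl⟩
  exact ⟨a, a.2, (Nat.cast_lt.2 a.2).trans_le hm, rfl⟩

theorem span_exists_lt_eq_span_range (u : ℕ → E) (m : ℕ) :
    Submodule.span 𝕜 {w | ∃ n < m, u n = w}
      = Submodule.span 𝕜 (Set.range fun a : Fin m => u a) := by
  simpa [initialSpan] using initialSpan_eq_span_range (𝕜 := 𝕜) (N := ⊤) u (m := m) le_top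

instance initialSpan_finiteDimensional (N : ℕ∞) (u : ℕ → E) (m : ℕ) :
    FiniteDimensional 𝕜 (initialSpan 𝕜 N u m) :=
  have := FiniteDimensional.span_of_finite 𝕜 (Set.finite_range fun a : Fin m => u a)
  Submodule.finiteDimensional_of_le (initialSpan_le_span_range N u m)

theorem finrank_initialSpan_le (N : ℕ∞) (u : ℕ → E) (m : ℕ) :
    Module.finrank 𝕜 (initialSpan 𝕜 N u m) ≤ m :=
  have := FiniteDimensional.span_of_finite 𝕜 (Set.finite_range fun a : Fin m => u a)
  (Submodule.finrank_mono (initialSpan_le_span_range N u m)).trans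
    ((finrank_range_le_card _).trans_eq (Fintype.card_fin m))

namespace IsSpectralSystem

variable {A : E →L[𝕜] E} {N : ℕ∞} {μ : ℕ → ℝ} {u : ℕ → E}

theorem nonneg (h : IsSpectralSystem (𝕜 := 𝕜) A N μ u) (n : ℕ) : 0 ≤ μ n := by
  rcases lt_or_ge (n : ℕ∞) N with hn | hn
  · exact (h.pos n hn).le
  · exact (h.eq_zero n hn).ge

theorem lt_of_pos (h : IsSpectralSystem (𝕜 := 𝕜) A N μ u) {n : ℕ} (hn : 0 < μ n) :
    (n : ℕ∞) < N :=
  lt_of_not_ge fun h' => hn.ne' (h.eq_zero n h')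

theorem apply_mem_initialSpan (h : IsSpectralSystem (𝕜 := 𝕜) A N μ u) (m : ℕ) :
    ∀ x ∈ initialSpan 𝕜 N u m, A x ∈ initialSpan 𝕜 N u m := by
  suffices initialSpan 𝕜 N u m ≤ (initialSpan 𝕜 N u m).comap (A : E →ₗ[𝕜] E) from this
  refine Submodule.span_le.2 ?_
  rintro _ ⟨n, hnm, hn, rfl⟩
  rw [SetLike.mem_coe, Submodule.mem_comap, ContinuousLinearMap.coe_coe, h.apply_eq n hn]
  exact Submodule.smul_mem _ _ (Submodule.subset_span ⟨n, hnm, hn, rfl⟩)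

theorem orthonormal_fin (h : IsSpectralSystem (𝕜 := 𝕜) A N μ u) {m : ℕ} (hm : (m : ℕ∞) ≤ N) :
    Orthonormal 𝕜 (fun a : Fin m => u a) :=
  h.orthonormal.comp (fun a : Fin m => ⟨a, (Nat.cast_lt.2 a.2).trans_le hm⟩)
    fun _ _ hab => Fin.ext (congrArg Subtype.val hab)

theorem finrank_initialSpan (h : IsSpectralSystem (𝕜 := 𝕜) A N μ u) {m : ℕ}
    (hm : (m : ℕ∞) ≤ N) : Module.finrank 𝕜 (initialSpan 𝕜 N u m) = m := by
  rw [initialSpan_eq_span_range u hm,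
    finrank_span_eq_card (h.orthonormal_fin hm).linearIndependent, Fintype.card_fin]

theorem mul_norm_sq_le_re_inner (h : IsSpectralSystem (𝕜 := 𝕜) A N μ u) {n : ℕ}
    (hn : (n : ℕ∞) < N) {x : E} (hx : x ∈ initialSpan 𝕜 N u (n + 1)) :
    μ n * ‖x‖ ^ 2 ≤ RCLike.re (inner 𝕜 (A x) x) := by
  have hN : ((n + 1 : ℕ) : ℕ∞) ≤ N := by exact_mod_cast Order.add_one_le_of_lt hn
  rw [initialSpan_eq_span_range u hN] at hx
  exact mul_norm_sq_le_re_inner_of_mem_span (h.orthonormal_fin hN)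
    (fun a => h.apply_eq a ((Nat.cast_lt.2 a.2).trans_le hN))
    (fun a => h.antitone (Nat.lt_succ_iff.1 a.2)) hx

variable [CompleteSpace E]

theorem norm_compression_initialSpan_le (h : IsSpectralSystem (𝕜 := 𝕜) A N μ u)
    (hA : IsCompactOperator A) (hpos : A.IsPositive) (m : ℕ) :
    ‖compression A (initialSpan 𝕜 N u m)‖ ≤ μ m := by
  set S := initialSpan 𝕜 N u m
  by_cases h0 : compression A S = 0
  · rw [h0, norm_zero]
    exact h.nonneg m
  obtain ⟨w, hwS, hw1, hw⟩ :=
    exists_eigenvector_compression hA hpos (h.apply_mem_initialSpan m) h0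
  by_contra! hlt
  have hmem : w ∈ S := by
    refine Submodule.span_le.2 ?_ (h.mem_span _ w (norm_pos_iff.2 h0) hw)
    rintro _ ⟨n, hn, hnμ, rfl⟩
    exact Submodule.subset_span
      ⟨n, lt_of_not_ge fun hmn => (h.antitone hmn).not_gt (hnμ ▸ hlt), hn, rfl⟩
  rw [inner_self_eq_zero.1 (hwS w hmem), norm_zero] at hw1
  exact zero_ne_one hw1

theorem re_inner_le_mul_norm_sq (h : IsSpectralSystem (𝕜 := 𝕜) A N μ u)
    (hA : IsCompactOperator A) (hpos : A.IsPositive) (m : ℕ) {x : E}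
    (hx : x ∈ (initialSpan 𝕜 N u m)ᗮ) :
    RCLike.re (inner 𝕜 (A x) x) ≤ μ m * ‖x‖ ^ 2 := by
  rw [← compression_apply_of_mem_orthogonal hpos (h.apply_mem_initialSpan m) hx]
  exact (re_inner_apply_le_norm_mul _ _).trans (mul_le_mul_of_nonneg_right
    (h.norm_compression_initialSpan_le hA hpos m) (sq_nonneg _))

-- Courant–Fischer: evaluate the Rayleigh quotients of `B` and `A` at a vector `x` in the span of
-- the first `n + 1` eigenvectors of `B` for which `j x` is orthogonal to the first `n` of `A`.
theorem le_mul_add_norm [CompleteSpace F] (hμ : IsSpectralSystem (𝕜 := 𝕜) A N μ u)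
    (hA : IsCompactOperator A) (hpos : A.IsPositive)
    {B : F →L[𝕜] F} {N' : ℕ∞} {μ' : ℕ → ℝ} {u' : ℕ → F}
    (hμ' : IsSpectralSystem (𝕜 := 𝕜) B N' μ' u') (j : F →L[𝕜] E) (n : ℕ) :
    μ' n ≤ ‖j‖ ^ 2 * μ n + ‖adjoint j ∘L A ∘L j - B‖ := by
  have hμn := hμ.nonneg n
  rcases le_or_gt N' (n : ℕ∞) with hn | hn
  · rw [hμ'.eq_zero n hn]
    positivity
  have hN' : ((n + 1 : ℕ) : ℕ∞) ≤ N' := by exact_mod_cast Order.add_one_le_of_lt hn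
  obtain ⟨x, hx, hx0, hjx⟩ := exists_mem_ne_zero_apply_mem_orthogonal (j : F →ₗ[𝕜] E)
    (S := initialSpan 𝕜 N u n) (T := initialSpan 𝕜 N' u' (n + 1))
    (by rw [hμ'.finrank_initialSpan hN']; exact Nat.lt_succ_of_le (finrank_initialSpan_le N u n))
  refine le_of_mul_le_mul_right (a := ‖x‖ ^ 2) ?_ (by positivity)
  calc μ' n * ‖x‖ ^ 2 ≤ RCLike.re (inner 𝕜 (B x) x) := hμ'.mul_norm_sq_le_re_inner hn hx
    _ ≤ RCLike.re (inner 𝕜 (A (j x)) (j x)) + ‖adjoint j ∘L A ∘L j - B‖ * ‖x‖ ^ 2 :=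
      re_inner_apply_le_re_inner_add_norm_mul A B j x
    _ ≤ μ n * ‖j x‖ ^ 2 + ‖adjoint j ∘L A ∘L j - B‖ * ‖x‖ ^ 2 := by
      gcongr
      exact hμ.re_inner_le_mul_norm_sq hA hpos n hjx
    _ ≤ μ n * (‖j‖ * ‖x‖) ^ 2 + ‖adjoint j ∘L A ∘L j - B‖ * ‖x‖ ^ 2 := by
      gcongr
      exact j.le_opNorm x
    _ = (‖j‖ ^ 2 * μ n + ‖adjoint j ∘L A ∘L j - B‖) * ‖x‖ ^ 2 := by ring

theorem mul_norm_sub_starProjection_le (hμ : IsSpectralSystem (𝕜 := 𝕜) A N μ u)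
    (hA : IsCompactOperator A) (hpos : A.IsPositive) {B : F →L[𝕜] F} (j : F →L[𝕜] E) (m : ℕ)
    {β : ℝ} {x : F} (hx : B x = (β : 𝕜) • x) :
    (β - μ m) * ‖j x - (initialSpan 𝕜 N u m).starProjection (j x)‖
      ≤ ‖A ∘L j - j ∘L B‖ * ‖x‖ := by
  refine (_root_.mul_norm_sub_starProjection_le (hμ.apply_mem_initialSpan m)
    (fun w hw => hμ.re_inner_le_mul_norm_sq hA hpos m hw) β (j x)).trans ?_
  rw [← map_smul, ← hx]
  exact (A ∘L j - j ∘L B).le_opNorm x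

end IsSpectralSystem

end MinMax

section Gap

variable {𝕜 E F α : Type*} [RCLike 𝕜] [NormedAddCommGroup E] [InnerProductSpace 𝕜 E]
  [NormedAddCommGroup F] [InnerProductSpace 𝕜 F] [Fintype α]

theorem norm_coeff_le_norm_sum_of_orthonormal {v : α → E} (hv : Orthonormal 𝕜 v)
    (c : α → 𝕜) (a : α) : ‖c a‖ ≤ ‖∑ b, c b • v b‖ := by
  rw [← hv.inner_right_fintype c a]
  simpa [hv.1 a] using norm_inner_le_norm (𝕜 := 𝕜) (v a) (∑ b, c b • v b)

theorem infDist_apply_le_of_mem_span (T : Submodule 𝕜 E) (i : F →L[𝕜] E) {w : α → F}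
    (hw : Orthonormal 𝕜 w) {z : α → E} (hz : ∀ a, z a ∈ T) {y : F}
    (hy : y ∈ Submodule.span 𝕜 (Set.range w)) :
    Metric.infDist (i y) (T : Set E) ≤ ‖y‖ * ∑ a, ‖i (w a) - z a‖ := by
  obtain ⟨c, rfl⟩ := (Submodule.mem_span_range_iff_exists_fun 𝕜).1 hy
  have hmem : ∑ a, c a • z a ∈ T := T.sum_mem fun a _ => T.smul_mem _ (hz a)
  calc Metric.infDist (i (∑ a, c a • w a)) (T : Set E)
      ≤ ‖i (∑ a, c a • w a) - ∑ a, c a • z a‖ :=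
        (Metric.infDist_le_dist_of_mem hmem).trans_eq (dist_eq_norm _ _)
    _ = ‖∑ a, c a • (i (w a) - z a)‖ := by
        simp only [map_sum, map_smul, smul_sub, Finset.sum_sub_distrib]
    _ ≤ ∑ a, ‖∑ b, c b • w b‖ * ‖i (w a) - z a‖ := by
        refine (norm_sum_le _ _).trans (Finset.sum_le_sum fun a _ => ?_)
        rw [norm_smul]
        gcongr
        exact norm_coeff_le_norm_sum_of_orthonormal hw c a
    _ = ‖∑ a, c a • w a‖ * ∑ a, ‖i (w a) - z a‖ := (Finset.mul_sum _ _ _).symm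

theorem subspaceGap_nonneg (A B : Submodule 𝕜 E) : 0 ≤ subspaceGap A B :=
  le_max_of_le_left (Real.iSup_nonneg fun _ => Metric.infDist_nonneg)

theorem subspaceGap_span_map_span_le {v : α → E} {w : α → F} (hv : Orthonormal 𝕜 v)
    (hw : Orthonormal 𝕜 w) (i : F →L[𝕜] E) {c : ℝ} (hc0 : 0 ≤ c) (hc : ∀ y, ‖y‖ ≤ c * ‖i y‖)
    {z z' : α → E} (hz : ∀ a, z a ∈ (Submodule.span 𝕜 (Set.range w)).map (i : F →ₗ[𝕜] E))
    (hz' : ∀ a, z' a ∈ Submodule.span 𝕜 (Set.range v)) :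
    subspaceGap (Submodule.span 𝕜 (Set.range v))
      ((Submodule.span 𝕜 (Set.range w)).map (i : F →ₗ[𝕜] E))
      ≤ ∑ a, ‖v a - z a‖ + c * ∑ a, ‖i (w a) - z' a‖ := by
  have hleft : 0 ≤ ∑ a, ‖v a - z a‖ := by positivity
  have hright : 0 ≤ c * ∑ a, ‖i (w a) - z' a‖ := by positivity
  refine max_le (Real.iSup_le ?_ (by positivity)) (Real.iSup_le ?_ (by positivity))
  · rintro ⟨x, hx, hx1⟩
    have := infDist_apply_le_of_mem_span _ (ContinuousLinearMap.id 𝕜 E) hv hz hx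
    rw [hx1, one_mul] at this
    exact this.trans (le_add_of_nonneg_right hright)
  · rintro ⟨_, ⟨y, hy, rfl⟩, hy1⟩
    rw [ContinuousLinearMap.coe_coe] at hy1
    have hyc := hc y
    rw [hy1, mul_one] at hyc
    exact ((infDist_apply_le_of_mem_span _ i hw hz' hy).trans (by gcongr)).trans
      (le_add_of_nonneg_left hleft)

end Gap

section Retract

variable {𝕜 E F : Type*} [NontriviallyNormedField 𝕜] [NormedAddCommGroup E] [NormedSpace 𝕜 E]
  [SeminormedAddCommGroup F] [NormedSpace 𝕜 F]

theorem norm_sub_embed_retract_le_mul_infDist {i : F →L[𝕜] E} {π : E →L[𝕜] F}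
    (hπi : Function.LeftInverse π i) {c : ℝ} (hc0 : 0 < c)
    (hc : ‖ContinuousLinearMap.id 𝕜 E - i ∘L π‖ ≤ c) (x : E) :
    ‖x - i (π x)‖ ≤ c * Metric.infDist x (Set.range i) := by
  rw [← div_le_iff₀' hc0, Metric.le_infDist (Set.range_nonempty i)]
  rintro _ ⟨w, rfl⟩
  rw [div_le_iff₀' hc0, dist_eq_norm]
  refine (le_of_eq ?_).trans (ContinuousLinearMap.le_of_opNorm_le _ hc (x - i w))
  simp only [sub_apply, ContinuousLinearMap.id_apply, ContinuousLinearMap.comp_apply, map_sub,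
    hπi w, sub_self, sub_zero]

theorem embed_retract_of_mem_closure_range {i : F →L[𝕜] E} {π : E →L[𝕜] F}
    (hπi : Function.LeftInverse π i) {x : E}
    (hx : x ∈ (LinearMap.range (i : F →ₗ[𝕜] E)).topologicalClosure) : i (π x) = x := by
  rw [← SetLike.mem_coe, Submodule.topologicalClosure_coe] at hx
  refine closure_minimal (t := {x | i (π x) = x}) ?_
    (isClosed_eq (by fun_prop) continuous_id) hx
  rintro _ ⟨w, rfl⟩
  exact congrArg i (hπi w)

end Retract

section Embedding

variable {𝕜 E F : Type*} [RCLike 𝕜] [NormedAddCommGroup E] [InnerProductSpace 𝕜 E]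
  [CompleteSpace E] [NormedAddCommGroup F] [InnerProductSpace 𝕜 F] [CompleteSpace F]

theorem norm_sq_le_one_add_norm_id_sub_gram (i : F →L[𝕜] E) :
    ‖i‖ ^ 2 ≤ 1 + ‖ContinuousLinearMap.id 𝕜 F - adjoint i ∘L i‖ := by
  rw [sq, ← ContinuousLinearMap.norm_adjoint_comp_self]
  calc ‖adjoint i ∘L i‖
      = ‖ContinuousLinearMap.id 𝕜 F - (ContinuousLinearMap.id 𝕜 F - adjoint i ∘L i)‖ := by
        rw [sub_sub_cancel]
    _ ≤ 1 + ‖ContinuousLinearMap.id 𝕜 F - adjoint i ∘L i‖ :=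
        (norm_sub_le _ _).trans (add_le_add_left ContinuousLinearMap.norm_id_le _)

theorem adjoint_starProjection_closure_range (i : F →L[𝕜] E) (x : E) :
    adjoint i ((LinearMap.range (i : F →ₗ[𝕜] E)).topologicalClosure.starProjection x)
      = adjoint i x := by
  refine ext_inner_left 𝕜 fun w => ?_
  rw [ContinuousLinearMap.adjoint_inner_right, ContinuousLinearMap.adjoint_inner_right,
    ← sub_eq_zero, ← inner_sub_right, ← neg_sub, inner_neg_right, neg_eq_zero]
  exact (Submodule.mem_orthogonal _ _).1 (Submodule.sub_starProjection_mem_orthogonal x) _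
    (Submodule.le_topologicalClosure _ ⟨w, rfl⟩)

theorem pulledBackProjection_sub_adjoint {i : F →L[𝕜] E} {π : E →L[𝕜] F}
    (hπi : Function.LeftInverse π i) :
    pulledBackProjection i π - adjoint i
      = (ContinuousLinearMap.id 𝕜 F - adjoint i ∘L i) ∘L pulledBackProjection i π := by
  ext x
  simp only [pulledBackProjection, sub_apply, ContinuousLinearMap.comp_apply,
    ContinuousLinearMap.id_apply]
  rw [embed_retract_of_mem_closure_range hπi (Submodule.starProjection_apply_mem _ _),
    adjoint_starProjection_closure_range]

end Embedding

/-- The spaces `F h` approximate `E`: the `i h` embed them as retracts of `E`, with uniformly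
bounded retractions `π h` such that the projections `i h ∘ π h` converge strongly to the identity,
and the embeddings become isometric in the limit. -/
structure IsApproximation {𝕜 ι E : Type*} [RCLike 𝕜] (l : Filter ι)
    [NormedAddCommGroup E] [InnerProductSpace 𝕜 E] [CompleteSpace E]
    {F : ι → Type*} [∀ h, NormedAddCommGroup (F h)] [∀ h, InnerProductSpace 𝕜 (F h)]
    [∀ h, CompleteSpace (F h)] (i : ∀ h, F h →L[𝕜] E) (π : ∀ h, E →L[𝕜] F h) : Prop where
  leftInverse : ∀ h, Function.LeftInverse (π h) (i h)
  embed_bounded : UniformlyBounded i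
  retract_bounded : UniformlyBounded π
  tendsto_retract : ∀ x, Tendsto (fun h => ‖x - i h (π h x)‖) l (𝓝 0)
  tendsto_gram : Tendsto (fun h => ‖ContinuousLinearMap.id 𝕜 (F h) - adjoint (i h) ∘L i h‖) l (𝓝 0)

namespace IsApproximation

variable {𝕜 ι E : Type*} [RCLike 𝕜] {l : Filter ι}
  [NormedAddCommGroup E] [InnerProductSpace 𝕜 E] [CompleteSpace E]
  {F : ι → Type*} [∀ h, NormedAddCommGroup (F h)] [∀ h, InnerProductSpace 𝕜 (F h)]
  [∀ h, CompleteSpace (F h)] {i : ∀ h, F h →L[𝕜] E} {π : ∀ h, E →L[𝕜] F h}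

theorem of_tendsto_infDist (hπi : ∀ h, Function.LeftInverse (π h) (i h))
    (hi : UniformlyBounded i) (hπ : UniformlyBounded π) {S : Set E} (hS : Dense S)
    (hdist : ∀ v ∈ S, Tendsto (fun h => Metric.infDist v (Set.range (i h))) l (𝓝 0))
    (hgram : Tendsto (fun h => ‖ContinuousLinearMap.id 𝕜 (F h) - adjoint (i h) ∘L i h‖) l (𝓝 0)) :
    IsApproximation l i π := by
  have hX : UniformlyBounded fun h => ContinuousLinearMap.id 𝕜 E - i h ∘L π h :=
    (UniformlyBounded.const (ContinuousLinearMap.id 𝕜 E)).sub (hi.comp hπ)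
  refine ⟨hπi, hi, hπ, hX.tendsto_norm_apply_of_dense hS fun v hv => ?_, hgram⟩
  obtain ⟨c, hc0, hc⟩ := hX.exists_pos_bound
  exact squeeze_zero (fun _ => norm_nonneg _)
    (fun h => norm_sub_embed_retract_le_mul_infDist (hπi h) hc0 (hc h) v)
    (by simpa using (hdist v hv).const_mul c)

theorem tendsto_adjoint_sub_retract (H : IsApproximation l i π) (x : E) :
    Tendsto (fun h => ‖adjoint (i h) x - π h x‖) l (𝓝 0) := by
  have hgram : Tendsto (fun h => ‖(ContinuousLinearMap.id 𝕜 (F h) - adjoint (i h) ∘L i h) (π h x)‖)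
      l (𝓝 0) := by
    obtain ⟨c, hc⟩ := H.retract_bounded
    exact tendsto_norm_clm_apply H.tendsto_gram fun h => (π h).le_of_opNorm_le (hc h) x
  refine (tendsto_norm_sub
    (H.embed_bounded.adjoint.tendsto_norm_apply (H.tendsto_retract x)) hgram).congr fun h => ?_
  congr 1
  simp only [sub_apply, ContinuousLinearMap.id_apply, ContinuousLinearMap.comp_apply, map_sub]
  abel

theorem tendsto_sub_embed_adjoint (H : IsApproximation l i π) (x : E) :
    Tendsto (fun h => ‖x - i h (adjoint (i h) x)‖) l (𝓝 0) := by
  refine (tendsto_norm_sub (H.tendsto_retract x)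
    (H.embed_bounded.tendsto_norm_apply (H.tendsto_adjoint_sub_retract x))).congr fun h => ?_
  rw [map_sub, sub_sub, add_sub_cancel]

theorem exists_norm_le_mul_norm_embed (H : IsApproximation l i π) :
    ∃ c : ℝ, 0 ≤ c ∧ ∀ h y, ‖y‖ ≤ c * ‖i h y‖ := by
  obtain ⟨c, hc0, hc⟩ := H.retract_bounded.exists_pos_bound
  refine ⟨c, hc0.le, fun h y => ?_⟩
  simpa only [H.leftInverse h y] using (π h).le_of_opNorm_le (hc h) (i h y)

theorem tendsto_pulledBackProjection_sub_adjoint (H : IsApproximation l i π) :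
    Tendsto (fun h => ‖pulledBackProjection (i h) (π h) - adjoint (i h)‖) l (𝓝 0) := by
  simp only [pulledBackProjection_sub_adjoint (H.leftInverse _)]
  exact UniformlyBounded.tendsto_norm_comp_right
    (H.retract_bounded.comp (UniformlyBounded.starProjection _)) H.tendsto_gram

theorem tendsto_conj_comp {G : Type*} [NormedAddCommGroup G] [InnerProductSpace 𝕜 G]
    [CompleteSpace G] {D : ι → Type*} [∀ h, NormedAddCommGroup (D h)]
    [∀ h, InnerProductSpace 𝕜 (D h)] [∀ h, CompleteSpace (D h)] {j : ∀ h, D h →L[𝕜] G}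
    {ρ : ∀ h, G →L[𝕜] D h} (HE : IsApproximation l i π) (HG : IsApproximation l j ρ)
    {A : G →L[𝕜] E} {B : E →L[𝕜] G} {Ah : ∀ h, D h →L[𝕜] F h} {Bh : ∀ h, F h →L[𝕜] D h}
    (hAh : UniformlyBounded Ah) (hBh : UniformlyBounded Bh)
    (hA : Tendsto (fun h => ‖A - i h ∘L Ah h ∘L adjoint (j h)‖) l (𝓝 0))
    (hB : Tendsto (fun h => ‖B - j h ∘L Bh h ∘L adjoint (i h)‖) l (𝓝 0)) :
    Tendsto (fun h => ‖A ∘L B - i h ∘L (Ah h ∘L Bh h) ∘L adjoint (i h)‖) l (𝓝 0) := by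
  have hiA : UniformlyBounded fun h => i h ∘L Ah h := HE.embed_bounded.comp hAh
  have hBi : UniformlyBounded fun h => Bh h ∘L adjoint (i h) := hBh.comp HE.embed_bounded.adjoint
  have hleft : Tendsto (fun h => ‖(A - i h ∘L Ah h ∘L adjoint (j h)) ∘L B‖) l (𝓝 0) :=
    (UniformlyBounded.const B).tendsto_norm_comp_right hA
  have hright : Tendsto (fun h => ‖(i h ∘L Ah h ∘L adjoint (j h)) ∘L
      (B - j h ∘L Bh h ∘L adjoint (i h))‖) l (𝓝 0) :=
    (HE.embed_bounded.comp (hAh.comp HG.embed_bounded.adjoint)).tendsto_norm_comp hB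
  have hgram : Tendsto (fun h => ‖(i h ∘L Ah h) ∘L (ContinuousLinearMap.id 𝕜 (D h)
      - adjoint (j h) ∘L j h) ∘L (Bh h ∘L adjoint (i h))‖) l (𝓝 0) :=
    hiA.tendsto_norm_comp (hBi.tendsto_norm_comp_right HG.tendsto_gram)
  refine (tendsto_norm_sub (tendsto_norm_add hleft hright) hgram).congr fun h => ?_
  congr 1
  ext x
  simp only [sub_apply, add_apply, ContinuousLinearMap.comp_apply, ContinuousLinearMap.id_apply,
    map_sub]
  abel

end IsApproximation

theorem tendsto_zero_of_mul_le {ι : Type*} {l : Filter ι} {a b d : ι → ℝ} {d₀ : ℝ}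
    (hd : Tendsto d l (𝓝 d₀)) (hd₀ : 0 < d₀) (hb : Tendsto b l (𝓝 0)) (ha : ∀ h, 0 ≤ a h)
    (hab : ∀ᶠ h in l, d h * a h ≤ b h) : Tendsto a l (𝓝 0) := by
  refine squeeze_zero' (Eventually.of_forall ha) ?_ (by simpa using hb.div hd hd₀.ne')
  filter_upwards [hab, hd.eventually_const_lt hd₀] with h hh hpos
  exact (le_div_iff₀' hpos).2 hh

/-- Convergence in norm, `i h ∘ Kh h ∘ (i h)* → K`, of positive compact operators on spaces `F h`
that approximate `E`. -/
structure PositiveCompactConverge {𝕜 ι E : Type*} [RCLike 𝕜] (l : Filter ι)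
    [NormedAddCommGroup E] [InnerProductSpace 𝕜 E] [CompleteSpace E]
    {F : ι → Type*} [∀ h, NormedAddCommGroup (F h)] [∀ h, InnerProductSpace 𝕜 (F h)]
    [∀ h, CompleteSpace (F h)] (i : ∀ h, F h →L[𝕜] E) (π : ∀ h, E →L[𝕜] F h)
    (K : E →L[𝕜] E) (Kh : ∀ h, F h →L[𝕜] F h) : Prop where
  approx : IsApproximation l i π
  compact : IsCompactOperator K
  positive : K.IsPositive
  compact_discrete : ∀ h, IsCompactOperator (Kh h)
  positive_discrete : ∀ h, (Kh h).IsPositive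
  bounded : UniformlyBounded Kh
  tendsto_conj : Tendsto (fun h => ‖K - i h ∘L Kh h ∘L adjoint (i h)‖) l (𝓝 0)

namespace PositiveCompactConverge

variable {𝕜 ι E : Type*} [RCLike 𝕜] {l : Filter ι}
  [NormedAddCommGroup E] [InnerProductSpace 𝕜 E] [CompleteSpace E]
  {F : ι → Type*} [∀ h, NormedAddCommGroup (F h)] [∀ h, InnerProductSpace 𝕜 (F h)]
  [∀ h, CompleteSpace (F h)] {i : ∀ h, F h →L[𝕜] E} {π : ∀ h, E →L[𝕜] F h}
  {K : E →L[𝕜] E} {Kh : ∀ h, F h →L[𝕜] F h}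

theorem tendsto_commutator (H : PositiveCompactConverge l i π K Kh) :
    Tendsto (fun h => ‖K ∘L i h - i h ∘L Kh h‖) l (𝓝 0) := by
  refine (tendsto_norm_sub (H.approx.embed_bounded.tendsto_norm_comp_right H.tendsto_conj)
    ((H.approx.embed_bounded.comp H.bounded).tendsto_norm_comp H.approx.tendsto_gram)).congr
    fun h => ?_
  congr 1
  ext x
  simp

theorem norm_adjoint_commutator (H : PositiveCompactConverge l i π K Kh) (h : ι) :
    ‖Kh h ∘L adjoint (i h) - adjoint (i h) ∘L K‖ = ‖K ∘L i h - i h ∘L Kh h‖ := by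
  rw [← norm_neg, ← LinearIsometryEquiv.norm_map adjoint (K ∘L i h - i h ∘L Kh h), map_sub,
    ContinuousLinearMap.adjoint_comp, ContinuousLinearMap.adjoint_comp,
    H.positive.isSelfAdjoint.adjoint_eq, (H.positive_discrete h).isSelfAdjoint.adjoint_eq, neg_sub]

theorem tendsto_pullback (H : PositiveCompactConverge l i π K Kh) :
    Tendsto (fun h => ‖adjoint (i h) ∘L K ∘L i h - Kh h‖) l (𝓝 0) := by
  refine (tendsto_norm_sub (H.approx.embed_bounded.adjoint.tendsto_norm_comp H.tendsto_commutator)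
    (H.bounded.tendsto_norm_comp_right H.approx.tendsto_gram)).congr fun h => ?_
  congr 1
  ext x
  simp

theorem tendsto_comp_pulledBackProjection (H : PositiveCompactConverge l i π K Kh) :
    Tendsto (fun h => ‖K - i h ∘L Kh h ∘L pulledBackProjection (i h) (π h)‖) l (𝓝 0) := by
  refine (tendsto_norm_sub H.tendsto_conj
    ((H.approx.embed_bounded.comp H.bounded).tendsto_norm_comp
      H.approx.tendsto_pulledBackProjection_sub_adjoint)).congr fun h => ?_
  congr 1
  ext x
  simp

variable {N : ℕ∞} {μ : ℕ → ℝ} {u : ℕ → E} {Nh : ι → ℕ∞} {μh : ι → ℕ → ℝ} {uh : ∀ h, ℕ → F h}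

theorem discrete_eigenvalue_le (H : PositiveCompactConverge l i π K Kh)
    (hμ : IsSpectralSystem (𝕜 := 𝕜) K N μ u)
    (hμh : ∀ h, IsSpectralSystem (𝕜 := 𝕜) (Kh h) (Nh h) (μh h) (uh h)) (n : ℕ) (h : ι) :
    μh h n ≤ (1 + ‖ContinuousLinearMap.id 𝕜 (F h) - adjoint (i h) ∘L i h‖) * μ n
      + ‖adjoint (i h) ∘L K ∘L i h - Kh h‖ := by
  refine (hμ.le_mul_add_norm H.compact H.positive (hμh h) (i h) n).trans ?_
  have := hμ.nonneg n
  gcongr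
  exact norm_sq_le_one_add_norm_id_sub_gram (i h)

theorem eigenvalue_le (H : PositiveCompactConverge l i π K Kh)
    (hμ : IsSpectralSystem (𝕜 := 𝕜) K N μ u)
    (hμh : ∀ h, IsSpectralSystem (𝕜 := 𝕜) (Kh h) (Nh h) (μh h) (uh h)) (n : ℕ) (h : ι) :
    μ n ≤ (1 + ‖ContinuousLinearMap.id 𝕜 (F h) - adjoint (i h) ∘L i h‖) * μh h n
      + ‖K - i h ∘L Kh h ∘L adjoint (i h)‖ := by
  have hle := (hμh h).le_mul_add_norm (H.compact_discrete h) (H.positive_discrete h) hμ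
    (adjoint (i h)) n
  rw [ContinuousLinearMap.adjoint_adjoint, LinearIsometryEquiv.norm_map, norm_sub_rev] at hle
  refine hle.trans ?_
  have := (hμh h).nonneg n
  gcongr
  exact norm_sq_le_one_add_norm_id_sub_gram (i h)

theorem tendsto_eigenvalue (H : PositiveCompactConverge l i π K Kh)
    (hμ : IsSpectralSystem (𝕜 := 𝕜) K N μ u)
    (hμh : ∀ h, IsSpectralSystem (𝕜 := 𝕜) (Kh h) (Nh h) (μh h) (uh h)) (n : ℕ) :
    Tendsto (fun h => μh h n) l (𝓝 (μ n)) := by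
  set δ : ι → ℝ := fun h => ‖ContinuousLinearMap.id 𝕜 (F h) - adjoint (i h) ∘L i h‖
  have hδ : Tendsto (fun h => 1 + δ h) l (𝓝 1) := by simpa using H.approx.tendsto_gram.const_add 1
  have hupper : Tendsto (fun h => (1 + δ h) * μ n + ‖adjoint (i h) ∘L K ∘L i h - Kh h‖) l
      (𝓝 (μ n)) := by
    simpa using (hδ.mul_const (μ n)).add H.tendsto_pullback
  have hlower : Tendsto (fun h => (μ n - ‖K - i h ∘L Kh h ∘L adjoint (i h)‖) / (1 + δ h)) l
      (𝓝 (μ n)) := by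
    simpa [Pi.div_def] using (H.tendsto_conj.const_sub (μ n)).div hδ one_ne_zero
  refine tendsto_of_tendsto_of_tendsto_of_le_of_le hlower hupper (fun h => ?_)
    (H.discrete_eigenvalue_le hμ hμh n)
  rw [div_le_iff₀' (by positivity), sub_le_iff_le_add]
  exact H.eigenvalue_le hμ hμh n h

theorem eventually_lt_card (H : PositiveCompactConverge l i π K Kh)
    (hμ : IsSpectralSystem (𝕜 := 𝕜) K N μ u)
    (hμh : ∀ h, IsSpectralSystem (𝕜 := 𝕜) (Kh h) (Nh h) (μh h) (uh h)) {n : ℕ}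
    (hn : (n : ℕ∞) < N) : ∀ᶠ h in l, (n : ℕ∞) < Nh h := by
  filter_upwards [(H.tendsto_eigenvalue hμ hμh n).eventually_const_lt (hμ.pos n hn)] with h hh
  exact (hμh h).lt_of_pos hh

theorem eventually_le_card (H : PositiveCompactConverge l i π K Kh)
    (hμ : IsSpectralSystem (𝕜 := 𝕜) K N μ u)
    (hμh : ∀ h, IsSpectralSystem (𝕜 := 𝕜) (Kh h) (Nh h) (μh h) (uh h)) {m : ℕ}
    (hm : (m : ℕ∞) ≤ N) : ∀ᶠ h in l, (m : ℕ∞) ≤ Nh h := by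
  cases m with
  | zero => exact Eventually.of_forall fun h => by simp
  | succ n =>
    filter_upwards [H.eventually_lt_card hμ hμh
      ((Nat.cast_lt.2 n.lt_succ_self).trans_le hm)] with h hh
    exact_mod_cast Order.add_one_le_of_lt hh

theorem tendsto_sub_embed_starProjection (H : PositiveCompactConverge l i π K Kh)
    (hμ : IsSpectralSystem (𝕜 := 𝕜) K N μ u)
    (hμh : ∀ h, IsSpectralSystem (𝕜 := 𝕜) (Kh h) (Nh h) (μh h) (uh h)) {a m : ℕ}
    (ha : (a : ℕ∞) < N) (hgap : μ m < μ a) :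
    Tendsto (fun h => ‖u a - i h ((initialSpan 𝕜 (Nh h) (uh h) m).starProjection
      (adjoint (i h) (u a)))‖) l (𝓝 0) := by
  have hproj : Tendsto (fun h => ‖adjoint (i h) (u a)
      - (initialSpan 𝕜 (Nh h) (uh h) m).starProjection (adjoint (i h) (u a))‖) l (𝓝 0) := by
    refine tendsto_zero_of_mul_le ((H.tendsto_eigenvalue hμ hμh m).const_sub (μ a))
      (sub_pos.2 hgap) H.tendsto_commutator (fun _ => norm_nonneg _)
      (Eventually.of_forall fun h => ?_)
    refine ((hμh h).mul_norm_sub_starProjection_le (H.compact_discrete h) (H.positive_discrete h)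
      (adjoint (i h)) m (hμ.apply_eq a ha)).trans_eq ?_
    rw [H.norm_adjoint_commutator h, hμ.orthonormal.1 ⟨a, ha⟩, mul_one]
  refine (tendsto_norm_add (H.approx.tendsto_sub_embed_adjoint (u a))
    (H.approx.embed_bounded.tendsto_norm_apply hproj)).congr fun h => ?_
  rw [map_sub, sub_add_sub_cancel]

theorem tendsto_embed_sub_starProjection (H : PositiveCompactConverge l i π K Kh)
    (hμ : IsSpectralSystem (𝕜 := 𝕜) K N μ u)
    (hμh : ∀ h, IsSpectralSystem (𝕜 := 𝕜) (Kh h) (Nh h) (μh h) (uh h)) {a m : ℕ}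
    (ha : (a : ℕ∞) < N) (hgap : μ m < μ a) :
    Tendsto (fun h => ‖i h (uh h a) - (initialSpan 𝕜 N u m).starProjection (i h (uh h a))‖) l
      (𝓝 0) := by
  refine tendsto_zero_of_mul_le ((H.tendsto_eigenvalue hμ hμh a).sub_const (μ m))
    (sub_pos.2 hgap) H.tendsto_commutator (fun _ => norm_nonneg _) ?_
  filter_upwards [H.eventually_lt_card hμ hμh ha] with h hah
  refine (hμ.mul_norm_sub_starProjection_le H.compact H.positive (i h) m
    ((hμh h).apply_eq a hah)).trans_eq ?_
  rw [(hμh h).orthonormal.1 ⟨a, hah⟩, mul_one]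

theorem tendsto_gap (H : PositiveCompactConverge l i π K Kh)
    (hμ : IsSpectralSystem (𝕜 := 𝕜) K N μ u)
    (hμh : ∀ h, IsSpectralSystem (𝕜 := 𝕜) (Kh h) (Nh h) (μh h) (uh h)) {m : ℕ}
    (hm : (m : ℕ∞) ≤ N) (hgap : ∀ a < m, μ m < μ a) :
    Tendsto (fun h => subspaceGap (Submodule.span 𝕜 {w | ∃ n < m, u n = w})
      ((Submodule.span 𝕜 {w | ∃ n < m, uh h n = w}).map (i h : F h →ₗ[𝕜] E))) l (𝓝 0) := by
  obtain ⟨c, hc0, hc⟩ := H.approx.exists_norm_le_mul_norm_embed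
  have ha : ∀ a : Fin m, ((a : ℕ) : ℕ∞) < N := fun a => (Nat.cast_lt.2 a.2).trans_le hm
  have hbound : Tendsto (fun h =>
      ∑ a : Fin m, ‖u a - i h ((initialSpan 𝕜 (Nh h) (uh h) m).starProjection
        (adjoint (i h) (u a)))‖
      + c * ∑ a : Fin m, ‖i h (uh h a) - (initialSpan 𝕜 N u m).starProjection (i h (uh h a))‖) l
      (𝓝 0) := by
    simpa using (tendsto_finsetSum Finset.univ fun (a : Fin m) _ =>
        H.tendsto_sub_embed_starProjection hμ hμh (ha a) (hgap a a.2)).add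
      ((tendsto_finsetSum Finset.univ fun (a : Fin m) _ =>
        H.tendsto_embed_sub_starProjection hμ hμh (ha a) (hgap a a.2)).const_mul c)
  refine squeeze_zero' (Eventually.of_forall fun _ => subspaceGap_nonneg _ _) ?_ hbound
  filter_upwards [H.eventually_le_card hμ hμh hm] with h hmh
  simp only [span_exists_lt_eq_span_range]
  refine subspaceGap_span_map_span_le (hμ.orthonormal_fin hm) ((hμh h).orthonormal_fin hmh) (i h)
    hc0 (hc h) (fun a => ?_) (fun a => ?_)
  · rw [← initialSpan_eq_span_range (uh h) hmh]
    exact Submodule.mem_map_of_mem (Submodule.starProjection_apply_mem _ _)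
  · rw [← initialSpan_eq_span_range u hm]
    exact Submodule.starProjection_apply_mem _ _

end PositiveCompactConverge

section UnboundedOperator

variable {𝕜 E F : Type*} [RCLike 𝕜] [NormedAddCommGroup E] [InnerProductSpace 𝕜 E]
  [NormedAddCommGroup F] [InnerProductSpace 𝕜 F]

/-- The kernel of an unbounded operator, as a subspace of the ambient space. -/
def operatorKernel (A : E →ₗ.[𝕜] F) : Submodule 𝕜 E :=
  (LinearMap.ker A.toFun).map A.domain.subtype

/-- The range of an unbounded operator. -/
def operatorRange (A : E →ₗ.[𝕜] F) : Submodule 𝕜 F :=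
  LinearMap.range A.toFun

theorem mem_operatorKernel {A : E →ₗ.[𝕜] F} {x : E} :
    x ∈ operatorKernel A ↔ ∃ hx : x ∈ A.domain, A ⟨x, hx⟩ = 0 := by
  constructor
  · rintro ⟨v, hv, rfl⟩
    exact ⟨v.2, hv⟩
  · rintro ⟨hx, h⟩
    exact ⟨⟨x, hx⟩, h, rfl⟩

theorem apply_mem_operatorRange (A : E →ₗ.[𝕜] F) (x : A.domain) : A x ∈ operatorRange A :=
  ⟨x, rfl⟩

theorem isClosed_operatorKernel {A : E →ₗ.[𝕜] F} (hA : A.IsClosed) :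
    IsClosed (operatorKernel A : Set E) := by
  have hgraph : (operatorKernel A : Set E)
      = (fun x => (x, (0 : F))) ⁻¹' (A.graph : Set (E × F)) := by
    ext x
    simp only [SetLike.mem_coe, Set.mem_preimage, LinearPMap.mem_graph_iff, mem_operatorKernel]
    constructor
    · rintro ⟨hx, h⟩
      exact ⟨⟨x, hx⟩, rfl, h⟩
    · rintro ⟨v, rfl, h⟩
      exact ⟨v.2, h⟩
  rw [hgraph]
  exact IsClosed.preimage (by fun_prop) hA

/-- `z` is the least-squares solution of `A z = g` of minimal norm: `A z` is the orthogonal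
projection of `g` onto the range of `A`, and `z` is orthogonal to the kernel. -/
def IsMinimalSolution (A : E →ₗ.[𝕜] F) (g : F) (z : A.domain) : Prop :=
  g - A z ∈ (operatorRange A)ᗮ ∧ (z : E) ∈ (operatorKernel A)ᗮ

namespace IsMinimalSolution

variable {A : E →ₗ.[𝕜] F} {g g' : F} {z z' : A.domain}

protected theorem add (h : IsMinimalSolution A g z) (h' : IsMinimalSolution A g' z') :
    IsMinimalSolution A (g + g') (z + z') := by
  refine ⟨?_, add_mem h.2 h'.2⟩
  rw [LinearPMap.map_add, add_sub_add_comm]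
  exact add_mem h.1 h'.1

protected theorem smul (c : 𝕜) (h : IsMinimalSolution A g z) :
    IsMinimalSolution A (c • g) (c • z) := by
  refine ⟨?_, Submodule.smul_mem _ c h.2⟩
  rw [LinearPMap.map_smul, ← smul_sub]
  exact Submodule.smul_mem _ c h.1

theorem unique (h : IsMinimalSolution A g z) (h' : IsMinimalSolution A g z') : z = z' := by
  have hA : A (z - z') = 0 := by
    have hmem : A (z - z') ∈ (operatorRange A)ᗮ := by
      rw [LinearPMap.map_sub, ← sub_sub_sub_cancel_left _ _ g]
      exact sub_mem h'.1 h.1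
    exact inner_self_eq_zero.1 (hmem _ (apply_mem_operatorRange A _))
  have hker : ((z - z' : A.domain) : E) ∈ operatorKernel A := mem_operatorKernel.2 ⟨_, hA⟩
  rw [← sub_eq_zero, ← Submodule.coe_eq_zero]
  exact inner_self_eq_zero.1 (sub_mem h.2 h'.2 _ hker)

theorem apply_eq_starProjection [(operatorRange A).HasOrthogonalProjection]
    (h : IsMinimalSolution A g z) : A z = (operatorRange A).starProjection g :=
  (Submodule.eq_starProjection_of_mem_orthogonal (apply_mem_operatorRange A z) h.1).symm

theorem exists_of_apply_eq [(operatorRange A).HasOrthogonalProjection]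
    [(operatorKernel A).HasOrthogonalProjection] {y : A.domain}
    (hy : A y = (operatorRange A).starProjection g) :
    ∃ z : A.domain, (z : E) = (operatorKernel A)ᗮ.starProjection (y : E) ∧
      IsMinimalSolution A g z := by
  obtain ⟨hmem, hzero⟩ :=
    mem_operatorKernel.1 ((operatorKernel A).starProjection_apply_mem (y : E))
  refine ⟨y - ⟨_, hmem⟩, (Submodule.starProjection_orthogonal_val _).symm, ?_,
    Submodule.sub_starProjection_mem_orthogonal _⟩
  rw [LinearPMap.map_sub, hzero, sub_zero, hy]
  exact Submodule.sub_starProjection_mem_orthogonal g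

theorem exists_of_tendsto [(operatorRange A).HasOrthogonalProjection] (hA : A.IsClosed)
    {s : ℕ → F} {w : ℕ → A.domain} (h : ∀ n, IsMinimalSolution A (s n) (w n)) {y : E}
    (hs : Tendsto s atTop (𝓝 g)) (hw : Tendsto (fun n => (w n : E)) atTop (𝓝 y)) :
    ∃ z : A.domain, (z : E) = y ∧ IsMinimalSolution A g z := by
  have hlim : Tendsto (fun n => ((w n : E), A (w n))) atTop
      (𝓝 (y, (operatorRange A).starProjection g)) := by
    simp only [(h _).apply_eq_starProjection]
    exact hw.prodMk_nhds (((ContinuousLinearMap.continuous _).tendsto g).comp hs)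
  obtain ⟨z, rfl, hz⟩ := LinearPMap.mem_graph_iff _ |>.1
    (hA.mem_of_tendsto hlim (Eventually.of_forall fun n => A.mem_graph (w n)))
  refine ⟨z, rfl, ?_, (Submodule.isClosed_orthogonal _).mem_of_tendsto hw
    (Eventually.of_forall fun n => (h n).2)⟩
  rw [hz]
  exact Submodule.sub_starProjection_mem_orthogonal g

end IsMinimalSolution

theorem exists_isMinimalSolution (A : E →ₗ.[𝕜] F) [(operatorRange A).HasOrthogonalProjection]
    [(operatorKernel A).HasOrthogonalProjection] (g : F) :
    ∃ z : A.domain, IsMinimalSolution A g z := by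
  obtain ⟨y, hy⟩ := (operatorRange A).starProjection_apply_mem g
  obtain ⟨z, -, hz⟩ := IsMinimalSolution.exists_of_apply_eq (A := A) hy
  exact ⟨z, hz⟩

/-- `T` is the partial inverse (Moore–Penrose inverse) of the unbounded operator `A`. -/
structure IsPartialInverse (A : E →ₗ.[𝕜] F) (T : F →L[𝕜] E) : Prop where
  mem_domain : ∀ g, T g ∈ A.domain
  isMinimalSolution : ∀ g, IsMinimalSolution A g ⟨T g, mem_domain g⟩

theorem exists_isPartialInverse [CompleteSpace E] [CompleteSpace F] {A : E →ₗ.[𝕜] F}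
    (hA : A.IsClosed) (hR : IsClosed (operatorRange A : Set F)) : ∃ T, IsPartialInverse A T := by
  have : CompleteSpace (operatorKernel A) := (isClosed_operatorKernel hA).completeSpace_coe
  have : CompleteSpace (operatorRange A) := hR.completeSpace_coe
  choose f hf using exists_isMinimalSolution A
  let L : F →ₗ[𝕜] E :=
    { toFun := fun g => f g
      map_add' := fun a b => congrArg Subtype.val ((hf (a + b)).unique ((hf a).add (hf b)))
      map_smul' := fun c a => congrArg Subtype.val ((hf (c • a)).unique ((hf a).smul c)) }
  have hL : Continuous L := L.continuous_of_seq_closed_graph fun s x y hs hy => by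
    obtain ⟨z, rfl, hz⟩ := IsMinimalSolution.exists_of_tendsto hA (fun n => hf (s n)) hs hy
    exact congrArg Subtype.val (hz.unique (hf x))
  exact ⟨⟨L, hL⟩, fun g => (f g).2, hf⟩

namespace IsPartialInverse

variable {A : E →ₗ.[𝕜] F} {T : F →L[𝕜] E}

theorem mem_orthogonal (hT : IsPartialInverse A T) (g : F) : T g ∈ (operatorKernel A)ᗮ :=
  (hT.isMinimalSolution g).2

theorem eq_apply (hT : IsPartialInverse A T) {g : F} {z : A.domain}
    (hz : IsMinimalSolution A g z) : T g = z :=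
  congrArg Subtype.val ((hT.isMinimalSolution g).unique hz)

theorem operator_apply (hT : IsPartialInverse A T) {g : F} (hg : g ∈ operatorRange A) :
    A ⟨T g, hT.mem_domain g⟩ = g := by
  have hmem := (hT.isMinimalSolution g).1 _
    (sub_mem hg (apply_mem_operatorRange A ⟨T g, hT.mem_domain g⟩))
  exact (sub_eq_zero.1 (inner_self_eq_zero.1 hmem)).symm

theorem apply_eq_zero (hT : IsPartialInverse A T) {g : F} (hg : g ∈ (operatorRange A)ᗮ) :
    T g = 0 :=
  hT.eq_apply (z := 0) ⟨by rwa [LinearPMap.map_zero, sub_zero], zero_mem _⟩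

theorem sub_apply_mem_operatorKernel (hT : IsPartialInverse A T) (x : A.domain) :
    (x : E) - T (A x) ∈ operatorKernel A := by
  refine mem_operatorKernel.2 ⟨sub_mem x.2 (hT.mem_domain _), ?_⟩
  change A (x - ⟨T (A x), hT.mem_domain _⟩) = 0
  rw [LinearPMap.map_sub, hT.operator_apply (apply_mem_operatorRange A x), sub_self]

theorem adjoint_apply_mem_operatorRange [CompleteSpace E] [CompleteSpace F]
    [(operatorRange A).HasOrthogonalProjection] (hT : IsPartialInverse A T) (x : E) :
    adjoint T x ∈ operatorRange A := by
  rw [← Submodule.orthogonal_orthogonal (operatorRange A)]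
  intro g hg
  rw [ContinuousLinearMap.adjoint_inner_right, hT.apply_eq_zero hg, inner_zero_left]

end IsPartialInverse

end UnboundedOperator

section Intertwining

variable {𝕜 E F E' F' : Type*} [RCLike 𝕜] [NormedAddCommGroup E] [InnerProductSpace 𝕜 E]
  [NormedAddCommGroup F] [InnerProductSpace 𝕜 F] [NormedAddCommGroup E'] [InnerProductSpace 𝕜 E']
  [NormedAddCommGroup F'] [InnerProductSpace 𝕜 F'] {A : E →ₗ.[𝕜] F} {A' : E' →ₗ.[𝕜] F'}

/-- The bounded operators `f` and `g` intertwine the unbounded operators `A` and `A'`: `f` maps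
the domain of `A` into that of `A'`, and `A' ∘ f = g ∘ A` there. -/
def Intertwines (A : E →ₗ.[𝕜] F) (A' : E' →ₗ.[𝕜] F') (f : E →L[𝕜] E') (g : F →L[𝕜] F') : Prop :=
  ∀ x : A.domain, ∃ hx : f x ∈ A'.domain, A' ⟨f x, hx⟩ = g (A x)

namespace Intertwines

variable {f : E →L[𝕜] E'} {g : F →L[𝕜] F'}

theorem map_mem_operatorRange (h : Intertwines A A' f g) {y : F} (hy : y ∈ operatorRange A) :
    g y ∈ operatorRange A' := by
  obtain ⟨x, rfl⟩ := hy
  obtain ⟨hx, hAx⟩ := h x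
  exact ⟨⟨f x, hx⟩, hAx⟩

theorem map_mem_operatorKernel (h : Intertwines A A' f g) {x : E} (hx : x ∈ operatorKernel A) :
    f x ∈ operatorKernel A' := by
  obtain ⟨hx, h0⟩ := mem_operatorKernel.1 hx
  obtain ⟨hfx, hAx⟩ := h ⟨x, hx⟩
  exact mem_operatorKernel.2 ⟨hfx, by rw [hAx, h0, map_zero]⟩

end Intertwines

theorem IsPartialInverse.eq_of_retraction {T : F →L[𝕜] E} {T' : F' →L[𝕜] E'}
    (hT : IsPartialInverse A T) (hT' : IsPartialInverse A' T') {i : E' →L[𝕜] E} {j : F' →L[𝕜] F}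
    {π : E →L[𝕜] E'} {ρ : F →L[𝕜] F'} (hij : Intertwines A' A i j) (hπρ : Intertwines A A' π ρ)
    (hρj : Function.LeftInverse ρ j) [(operatorRange A').HasOrthogonalProjection]
    [(operatorKernel A').HasOrthogonalProjection] :
    T' = (operatorKernel A')ᗮ.starProjection ∘L π ∘L T ∘L j
      ∘L (operatorRange A').starProjection := by
  ext g
  set b := (operatorRange A').starProjection g
  have hjb : j b ∈ operatorRange A :=
    hij.map_mem_operatorRange (Submodule.starProjection_apply_mem _ g)
  obtain ⟨hy, hAy⟩ := hπρ ⟨T (j b), hT.mem_domain _⟩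
  rw [hT.operator_apply hjb, hρj b] at hAy
  obtain ⟨z, hz, hzmin⟩ := IsMinimalSolution.exists_of_apply_eq hAy
  exact (hT'.eq_apply hzmin).trans hz

end Intertwining

/-- The operators `Ah h`, between spaces that approximate those of `A`, are intertwined with `A` by
the embeddings and by the retractions. -/
structure IsOperatorApproximation {𝕜 ι E F : Type*} [RCLike 𝕜] (l : Filter ι)
    [NormedAddCommGroup E] [InnerProductSpace 𝕜 E] [CompleteSpace E]
    [NormedAddCommGroup F] [InnerProductSpace 𝕜 F] [CompleteSpace F] (A : E →ₗ.[𝕜] F)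
    {Eh Fh : ι → Type*} [∀ h, NormedAddCommGroup (Eh h)] [∀ h, InnerProductSpace 𝕜 (Eh h)]
    [∀ h, CompleteSpace (Eh h)] [∀ h, NormedAddCommGroup (Fh h)]
    [∀ h, InnerProductSpace 𝕜 (Fh h)] [∀ h, CompleteSpace (Fh h)]
    (Ah : ∀ h, Eh h →ₗ.[𝕜] Fh h) (i : ∀ h, Eh h →L[𝕜] E) (π : ∀ h, E →L[𝕜] Eh h)
    (j : ∀ h, Fh h →L[𝕜] F) (ρ : ∀ h, F →L[𝕜] Fh h) : Prop where
  domain : IsApproximation l i π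
  codomain : IsApproximation l j ρ
  embed : ∀ h, Intertwines (Ah h) A (i h) (j h)
  retract : ∀ h, Intertwines A (Ah h) (π h) (ρ h)

namespace IsOperatorApproximation

variable {𝕜 ι E F : Type*} [RCLike 𝕜] {l : Filter ι}
  [NormedAddCommGroup E] [InnerProductSpace 𝕜 E] [CompleteSpace E]
  [NormedAddCommGroup F] [InnerProductSpace 𝕜 F] [CompleteSpace F] {A : E →ₗ.[𝕜] F}
  {Eh Fh : ι → Type*} [∀ h, NormedAddCommGroup (Eh h)] [∀ h, InnerProductSpace 𝕜 (Eh h)]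
  [∀ h, CompleteSpace (Eh h)] [∀ h, NormedAddCommGroup (Fh h)]
  [∀ h, InnerProductSpace 𝕜 (Fh h)] [∀ h, CompleteSpace (Fh h)]
  {Ah : ∀ h, Eh h →ₗ.[𝕜] Fh h} {i : ∀ h, Eh h →L[𝕜] E} {π : ∀ h, E →L[𝕜] Eh h}
  {j : ∀ h, Fh h →L[𝕜] F} {ρ : ∀ h, F →L[𝕜] Fh h} {T : F →L[𝕜] E} {Th : ∀ h, Fh h →L[𝕜] Eh h}

theorem tendsto_of_mem_orthogonal_operatorKernel (H : IsOperatorApproximation l A Ah i π j ρ)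
    [∀ h, (operatorKernel (Ah h)).HasOrthogonalProjection] {z : E}
    (hz : z ∈ (operatorKernel A)ᗮ) :
    Tendsto (fun h => ‖z - i h ((operatorKernel (Ah h))ᗮ.starProjection (π h z))‖) l (𝓝 0) := by
  have hker : ∀ h, (operatorKernel (Ah h)).starProjection (adjoint (i h) z) = 0 := fun h => by
    refine (Submodule.starProjection_apply_eq_zero_iff _).2 fun y hy => ?_
    rw [ContinuousLinearMap.adjoint_inner_right]
    exact hz _ ((H.embed h).map_mem_operatorKernel hy)
  have hproj : Tendsto (fun h => ‖i h ((operatorKernel (Ah h)).starProjection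
      (adjoint (i h) z - π h z))‖) l (𝓝 0) :=
    (H.domain.embed_bounded.comp (UniformlyBounded.starProjection _)).tendsto_norm_apply
      (H.domain.tendsto_adjoint_sub_retract z)
  refine (tendsto_norm_sub (H.domain.tendsto_retract z) hproj).congr fun h => ?_
  rw [map_sub, hker, zero_sub, Submodule.starProjection_orthogonal_val, map_sub, map_neg,
    sub_neg_eq_add, sub_sub_eq_add_sub, sub_add_eq_add_sub]

theorem tendsto_of_mem_operatorRange (H : IsOperatorApproximation l A Ah i π j ρ)
    [∀ h, (operatorRange (Ah h)).HasOrthogonalProjection] {b : F} (hb : b ∈ operatorRange A) :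
    Tendsto (fun h => ‖b - j h ((operatorRange (Ah h)).starProjection (adjoint (j h) b))‖) l
      (𝓝 0) := by
  have hproj : Tendsto (fun h => ‖j h ((operatorRange (Ah h)).starProjection
      (adjoint (j h) b - ρ h b))‖) l (𝓝 0) :=
    (H.codomain.embed_bounded.comp (UniformlyBounded.starProjection _)).tendsto_norm_apply
      (H.codomain.tendsto_adjoint_sub_retract b)
  refine (tendsto_norm_sub (H.codomain.tendsto_retract b) hproj).congr fun h => ?_
  rw [map_sub, Submodule.starProjection_eq_self_iff.2 ((H.retract h).map_mem_operatorRange hb),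
    map_sub, sub_sub_sub_cancel_right]

variable [∀ h, (operatorKernel (Ah h)).HasOrthogonalProjection]
  [∀ h, (operatorRange (Ah h)).HasOrthogonalProjection]

theorem partialInverse_eq (H : IsOperatorApproximation l A Ah i π j ρ)
    (hT : IsPartialInverse A T) (hTh : ∀ h, IsPartialInverse (Ah h) (Th h)) (h : ι) :
    Th h = (operatorKernel (Ah h))ᗮ.starProjection ∘L π h ∘L T ∘L j h
      ∘L (operatorRange (Ah h)).starProjection :=
  hT.eq_of_retraction (hTh h) (H.embed h) (H.retract h) (H.codomain.leftInverse h)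

theorem uniformlyBounded_partialInverse (H : IsOperatorApproximation l A Ah i π j ρ)
    (hT : IsPartialInverse A T) (hTh : ∀ h, IsPartialInverse (Ah h) (Th h)) :
    UniformlyBounded Th := by
  rw [funext (H.partialInverse_eq hT hTh)]
  exact (UniformlyBounded.starProjection _).comp <| H.domain.retract_bounded.comp <|
    (UniformlyBounded.const T).comp <| H.codomain.embed_bounded.comp <|
    UniformlyBounded.starProjection _

theorem isCompactOperator_partialInverse (H : IsOperatorApproximation l A Ah i π j ρ)
    (hT : IsPartialInverse A T) (hTh : ∀ h, IsPartialInverse (Ah h) (Th h))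
    (hcompact : IsCompactOperator T) (h : ι) : IsCompactOperator (Th h) := by
  rw [H.partialInverse_eq hT hTh]
  exact ((hcompact.comp_clm (j h ∘L (operatorRange (Ah h)).starProjection)).clm_comp
    (π h)).clm_comp (operatorKernel (Ah h))ᗮ.starProjection

theorem tendsto_partialInverse (H : IsOperatorApproximation l A Ah i π j ρ)
    [(operatorRange A).HasOrthogonalProjection]
    (hT : IsPartialInverse A T) (hTh : ∀ h, IsPartialInverse (Ah h) (Th h))
    (hcompact : IsCompactOperator T) :
    Tendsto (fun h => ‖T - i h ∘L Th h ∘L adjoint (j h)‖) l (𝓝 0) := by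
  set X : ι → E →L[𝕜] E := fun h => i h ∘L (operatorKernel (Ah h))ᗮ.starProjection ∘L π h with hX
  set Y : ι → F →L[𝕜] F := fun h => ContinuousLinearMap.id 𝕜 F
    - j h ∘L (operatorRange (Ah h)).starProjection ∘L adjoint (j h) with hY
  have hXb : UniformlyBounded X := H.domain.embed_bounded.comp
    ((UniformlyBounded.starProjection _).comp H.domain.retract_bounded)
  have hYb : UniformlyBounded Y := (UniformlyBounded.const _).sub
    (H.codomain.embed_bounded.comp
      ((UniformlyBounded.starProjection _).comp H.codomain.embed_bounded.adjoint))
  have hYadj : ∀ h, adjoint (Y h) = Y h := fun h => by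
    simp only [hY, map_sub, ContinuousLinearMap.adjoint_comp, ContinuousLinearMap.adjoint_adjoint,
      ContinuousLinearMap.adjoint_id]
    rw [(isSelfAdjoint_starProjection _).adjoint_eq, ContinuousLinearMap.comp_assoc]
  have hleft : Tendsto (fun h => ‖(ContinuousLinearMap.id 𝕜 E - X h) ∘L T‖) l (𝓝 0) :=
    ((UniformlyBounded.const _).sub hXb).tendsto_norm_comp_isCompactOperator hcompact
      fun g => H.tendsto_of_mem_orthogonal_operatorKernel (hT.mem_orthogonal g)
  have hright : Tendsto (fun h => ‖T ∘L Y h‖) l (𝓝 0) := by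
    refine hYb.tendsto_norm_isCompactOperator_comp hcompact fun x => ?_
    simp only [hYadj]
    exact H.tendsto_of_mem_operatorRange (hT.adjoint_apply_mem_operatorRange x)
  refine (tendsto_norm_add hleft (hXb.tendsto_norm_comp hright)).congr fun h => ?_
  rw [H.partialInverse_eq hT hTh]
  congr 1
  ext x
  simp [hX, hY]

end IsOperatorApproximation

section GreenOperator

variable {𝕜 E F G : Type*} [RCLike 𝕜] [NormedAddCommGroup E] [InnerProductSpace 𝕜 E]
  [NormedAddCommGroup F] [InnerProductSpace 𝕜 F] [NormedAddCommGroup G] [InnerProductSpace 𝕜 G]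
  {A : E →ₗ.[𝕜] F} {B : F →ₗ.[𝕜] G} {T : F →L[𝕜] E} {S : G →L[𝕜] F}

theorem exists_adjoint_apply_eq_zero [CompleteSpace E] (hA : Dense (A.domain : Set E)) {y : F}
    (hy : y ∈ (operatorRange A)ᗮ) : ∃ hy' : y ∈ A.adjoint.domain, A.adjoint ⟨y, hy'⟩ = 0 := by
  have hzero : ∀ x : A.domain, inner 𝕜 (0 : E) (x : E) = inner 𝕜 y (A x) := fun x => by
    rw [inner_zero_left, Submodule.inner_left_of_mem_orthogonal (apply_mem_operatorRange A x) hy]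
  have hy' : y ∈ A.adjoint.domain := LinearPMap.mem_adjoint_domain_of_exists _ ⟨0, hzero⟩
  exact ⟨hy', LinearPMap.adjoint_apply_eq hA ⟨y, hy'⟩ hzero⟩

theorem IsPartialInverse.norm_sq_add_norm_sq_le [(operatorRange A).HasOrthogonalProjection]
    (hT : IsPartialInverse A T) (g : F) :
    ‖T g‖ ^ 2 + ‖A ⟨T g, hT.mem_domain g⟩‖ ^ 2 ≤ (‖T‖ ^ 2 + 1) * ‖g‖ ^ 2 := by
  have hA : ‖A ⟨T g, hT.mem_domain g⟩‖ ≤ ‖g‖ := by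
    rw [(hT.isMinimalSolution g).apply_eq_starProjection]
    exact Submodule.norm_starProjection_apply_le _ g
  calc ‖T g‖ ^ 2 + ‖A ⟨T g, hT.mem_domain g⟩‖ ^ 2
      ≤ (‖T‖ * ‖g‖) ^ 2 + ‖g‖ ^ 2 := by gcongr; exact T.le_opNorm g
    _ = (‖T‖ ^ 2 + 1) * ‖g‖ ^ 2 := by ring

theorem starProjection_sub_operator_apply_mem_harmonic [(operatorKernel B).HasOrthogonalProjection]
    (hle : operatorRange A ≤ operatorKernel B) (hT : IsPartialInverse A T) (f : F) :
    (operatorKernel B).starProjection f - A ⟨T f, hT.mem_domain f⟩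
      ∈ operatorKernel B ⊓ (operatorRange A)ᗮ := by
  refine ⟨sub_mem (Submodule.starProjection_apply_mem _ f) (hle (apply_mem_operatorRange A _)), ?_⟩
  rw [← sub_sub_sub_cancel_left _ _ f]
  exact sub_mem (hT.isMinimalSolution f).1
    (Submodule.orthogonal_le hle (Submodule.sub_starProjection_mem_orthogonal f))

variable [CompleteSpace E] [CompleteSpace F] [CompleteSpace G]

theorem IsPartialInverse.inner_adjoint_apply_operator (hT : IsPartialInverse A T) (x : E)
    [(operatorKernel A).HasOrthogonalProjection] (v : A.domain) :
    inner 𝕜 (adjoint T x) (A v) = inner 𝕜 (x - (operatorKernel A).starProjection x) (v : E) := by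
  have hker := Submodule.inner_left_of_mem_orthogonal (hT.sub_apply_mem_operatorKernel v)
    (Submodule.sub_starProjection_mem_orthogonal (K := operatorKernel A) x)
  have himage := hT.mem_orthogonal (A v) _ ((operatorKernel A).starProjection_apply_mem x)
  rw [inner_sub_right, sub_eq_zero] at hker
  rw [ContinuousLinearMap.adjoint_inner_left, hker, inner_sub_left, himage, sub_zero]

/-- The operator `T* T + S S*`. If `T` and `S` are the partial inverses of two consecutive
differentials, it is the solution operator of the Hodge Laplacian between them. -/
noncomputable def greenOperator (T : F →L[𝕜] E) (S : G →L[𝕜] F) : F →L[𝕜] F :=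
  adjoint T ∘L T + S ∘L adjoint S

theorem isPositive_greenOperator (T : F →L[𝕜] E) (S : G →L[𝕜] F) :
    (greenOperator T S).IsPositive :=
  (ContinuousLinearMap.isPositive_adjoint_comp_self T).add
    (ContinuousLinearMap.isPositive_self_comp_adjoint S)

theorem isCompactOperator_greenOperator (hT : IsCompactOperator T) (hS : IsCompactOperator S) :
    IsCompactOperator (greenOperator T S) :=
  (hT.clm_comp (adjoint T)).add (hS.comp_clm (adjoint S))

theorem operator_greenOperator_apply [(operatorRange A).HasOrthogonalProjection]
    [(operatorRange B).HasOrthogonalProjection] (hle : operatorRange A ≤ operatorKernel B)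
    (hT : IsPartialInverse A T) (hS : IsPartialInverse B S) (f : F) :
    ∃ hu : greenOperator T S f ∈ B.domain, B ⟨greenOperator T S f, hu⟩ = adjoint S f := by
  obtain ⟨hmem, hzero⟩ := mem_operatorKernel.1 (hle (hT.adjoint_apply_mem_operatorRange (T f)))
  refine ⟨add_mem hmem (hS.mem_domain (adjoint S f)), ?_⟩
  change B (⟨_, hmem⟩ + ⟨_, hS.mem_domain (adjoint S f)⟩) = _
  rw [LinearPMap.map_add, hzero, zero_add,
    hS.operator_apply (hS.adjoint_apply_mem_operatorRange f)]

theorem inner_greenOperator_operator (hle : operatorRange A ≤ operatorKernel B)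
    (hT : IsPartialInverse A T) (hS : IsPartialInverse B S) (f : F) (τ : A.domain) :
    inner 𝕜 (greenOperator T S f) (A τ) = inner 𝕜 (T f) (τ : E) := by
  have hS0 : inner 𝕜 (S (adjoint S f)) (A τ) = 0 :=
    Submodule.inner_left_of_mem_orthogonal (hle (apply_mem_operatorRange A τ)) (hS.mem_orthogonal _)
  have hT0 : inner 𝕜 (T f) ((τ : E) - T (A τ)) = 0 :=
    Submodule.inner_left_of_mem_orthogonal (hT.sub_apply_mem_operatorKernel τ) (hT.mem_orthogonal f)
  rw [inner_sub_right, sub_eq_zero] at hT0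
  change inner 𝕜 (adjoint T (T f) + S (adjoint S f)) (A τ) = _
  rw [inner_add_left, hS0, add_zero, ContinuousLinearMap.adjoint_inner_left, hT0]

theorem inner_greenOperator_harmonic [(operatorRange A).HasOrthogonalProjection]
    (hT : IsPartialInverse A T) (hS : IsPartialInverse B S) (f : F) {q : F}
    (hq : q ∈ operatorKernel B ⊓ (operatorRange A)ᗮ) :
    inner 𝕜 (greenOperator T S f) q = 0 := by
  change inner 𝕜 (adjoint T (T f) + S (adjoint S f)) q = 0
  rw [inner_add_left, Submodule.inner_left_of_mem_orthogonal hq.1 (hS.mem_orthogonal _),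
    hq.2 _ (hT.adjoint_apply_mem_operatorRange (T f)), add_zero]

end GreenOperator

section GreenOperatorApproximation

variable {𝕜 ι E F G : Type*} [RCLike 𝕜] {l : Filter ι}
  [NormedAddCommGroup E] [InnerProductSpace 𝕜 E] [CompleteSpace E]
  [NormedAddCommGroup F] [InnerProductSpace 𝕜 F] [CompleteSpace F]
  [NormedAddCommGroup G] [InnerProductSpace 𝕜 G] [CompleteSpace G]
  {Eh Fh Gh : ι → Type*} [∀ h, NormedAddCommGroup (Eh h)] [∀ h, InnerProductSpace 𝕜 (Eh h)]
  [∀ h, CompleteSpace (Eh h)] [∀ h, NormedAddCommGroup (Fh h)]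
  [∀ h, InnerProductSpace 𝕜 (Fh h)] [∀ h, CompleteSpace (Fh h)]
  [∀ h, NormedAddCommGroup (Gh h)] [∀ h, InnerProductSpace 𝕜 (Gh h)] [∀ h, CompleteSpace (Gh h)]
  {i : ∀ h, Eh h →L[𝕜] E} {π : ∀ h, E →L[𝕜] Eh h} {j : ∀ h, Fh h →L[𝕜] F}
  {ρ : ∀ h, F →L[𝕜] Fh h} {m : ∀ h, Gh h →L[𝕜] G} {ψ : ∀ h, G →L[𝕜] Gh h}
  {T : F →L[𝕜] E} {Th : ∀ h, Fh h →L[𝕜] Eh h} {S : G →L[𝕜] F} {Sh : ∀ h, Gh h →L[𝕜] Fh h}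

theorem tendsto_adjoint_conj (hT : Tendsto (fun h => ‖T - i h ∘L Th h ∘L adjoint (j h)‖) l (𝓝 0)) :
    Tendsto (fun h => ‖adjoint T - j h ∘L adjoint (Th h) ∘L adjoint (i h)‖) l (𝓝 0) := by
  refine hT.congr fun h => ?_
  rw [← LinearIsometryEquiv.norm_map adjoint, map_sub, ContinuousLinearMap.adjoint_comp,
    ContinuousLinearMap.adjoint_comp, ContinuousLinearMap.adjoint_adjoint,
    ContinuousLinearMap.comp_assoc]

theorem tendsto_greenOperator (HE : IsApproximation l i π) (HF : IsApproximation l j ρ)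
    (HG : IsApproximation l m ψ) (hTh : UniformlyBounded Th) (hSh : UniformlyBounded Sh)
    (hT : Tendsto (fun h => ‖T - i h ∘L Th h ∘L adjoint (j h)‖) l (𝓝 0))
    (hS : Tendsto (fun h => ‖S - j h ∘L Sh h ∘L adjoint (m h)‖) l (𝓝 0)) :
    Tendsto (fun h => ‖greenOperator T S
      - j h ∘L greenOperator (Th h) (Sh h) ∘L adjoint (j h)‖) l (𝓝 0) := by
  refine (tendsto_norm_add
    (HF.tendsto_conj_comp HE hTh.adjoint hTh (tendsto_adjoint_conj hT) hT)
    (HF.tendsto_conj_comp HG hSh hSh.adjoint hS (tendsto_adjoint_conj hS))).congr fun h => ?_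
  rw [greenOperator, greenOperator, ContinuousLinearMap.add_comp, ContinuousLinearMap.comp_add,
    add_sub_add_comm]

theorem positiveCompactConverge_greenOperator {A : E →ₗ.[𝕜] F} {B : F →ₗ.[𝕜] G}
    {Ah : ∀ h, Eh h →ₗ.[𝕜] Fh h} {Bh : ∀ h, Fh h →ₗ.[𝕜] Gh h}
    [∀ h, (operatorKernel (Ah h)).HasOrthogonalProjection]
    [∀ h, (operatorRange (Ah h)).HasOrthogonalProjection]
    [∀ h, (operatorKernel (Bh h)).HasOrthogonalProjection]
    [∀ h, (operatorRange (Bh h)).HasOrthogonalProjection]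
    [(operatorRange A).HasOrthogonalProjection] [(operatorRange B).HasOrthogonalProjection]
    (HA : IsOperatorApproximation l A Ah i π j ρ) (HB : IsOperatorApproximation l B Bh j ρ m ψ)
    (hT : IsPartialInverse A T) (hTh : ∀ h, IsPartialInverse (Ah h) (Th h))
    (hS : IsPartialInverse B S) (hSh : ∀ h, IsPartialInverse (Bh h) (Sh h))
    (hTc : IsCompactOperator T) (hSc : IsCompactOperator S) :
    PositiveCompactConverge l j ρ (greenOperator T S) fun h => greenOperator (Th h) (Sh h) where
  approx := HA.codomain
  compact := isCompactOperator_greenOperator hTc hSc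
  positive := isPositive_greenOperator T S
  compact_discrete h := isCompactOperator_greenOperator
    (HA.isCompactOperator_partialInverse hT hTh hTc h)
    (HB.isCompactOperator_partialInverse hS hSh hSc h)
  positive_discrete h := isPositive_greenOperator (Th h) (Sh h)
  bounded := by
    have hThb := HA.uniformlyBounded_partialInverse hT hTh
    have hShb := HB.uniformlyBounded_partialInverse hS hSh
    exact (hThb.adjoint.comp hThb).add (hShb.comp hShb.adjoint)
  tendsto_conj := tendsto_greenOperator HA.domain HA.codomain HB.codomain
    (HA.uniformlyBounded_partialInverse hT hTh) (HB.uniformlyBounded_partialInverse hS hSh)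
    (HA.tendsto_partialInverse hT hTh hTc) (HB.tendsto_partialInverse hS hSh hSc)

end GreenOperatorApproximation

section PositiveEigenvalue

variable {𝕜 E : Type*} [RCLike 𝕜] [NormedAddCommGroup E] [InnerProductSpace 𝕜 E]
  {K : E →L[𝕜] E} {t : 𝕜} {v : E}

theorem mul_re_inner_apply_self_eq_norm_sq (hpos : K.IsPositive) (hv : t • K v = v) :
    t * (RCLike.re (inner 𝕜 (K v) v) : 𝕜) = ((‖v‖ ^ 2 : ℝ) : 𝕜) := by
  have hreal : (RCLike.re (inner 𝕜 (K v) v) : 𝕜) = inner 𝕜 (K v) v :=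
    hpos.isSymmetric.coe_re_inner_apply_self v
  rw [hreal, hpos.inner_left_eq_inner_right, ← inner_smul_right, hv, inner_self_eq_norm_sq_to_K,
    RCLike.ofReal_pow]

theorem exists_pos_eigenvalue_of_smul_apply_eq (hpos : K.IsPositive) (hv : t • K v = v)
    (hv0 : v ≠ 0) : ∃ s : ℝ, 0 < s ∧ K v = (s : 𝕜) • v ∧ t = ((s⁻¹ : ℝ) : 𝕜) := by
  set r := RCLike.re (inner 𝕜 (K v) v)
  have hvsq : 0 < ‖v‖ ^ 2 := by positivity
  have htr : t * (r : 𝕜) = ((‖v‖ ^ 2 : ℝ) : 𝕜) := mul_re_inner_apply_self_eq_norm_sq hpos hv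
  have hr0 : r ≠ 0 := by
    rintro h
    rw [h, RCLike.ofReal_zero, mul_zero, eq_comm, RCLike.ofReal_eq_zero] at htr
    exact hvsq.ne' htr
  have hr : 0 < r := (hpos.re_inner_nonneg_left v).lt_of_ne' hr0
  have ht : t = (((r / ‖v‖ ^ 2)⁻¹ : ℝ) : 𝕜) := by
    rw [inv_div, RCLike.ofReal_div, eq_div_iff (RCLike.ofReal_ne_zero.2 hr0), htr]
  refine ⟨r / ‖v‖ ^ 2, div_pos hr hvsq, ?_, ht⟩
  rw [ht, RCLike.ofReal_inv] at hv
  exact (inv_smul_eq_iff₀ (RCLike.ofReal_ne_zero.2 (div_pos hr hvsq).ne')).1 hv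

end PositiveEigenvalue

namespace HilbertComplex

section MixedProblem

variable {𝕜 : Type*} [RCLike 𝕜] {W : ℤ → Type*} [∀ k, NormedAddCommGroup (W k)]
  [∀ k, InnerProductSpace 𝕜 (W k)] [∀ k, CompleteSpace (W k)] {C : HilbertComplex 𝕜 W}

theorem operatorRange_le_operatorKernel (C : HilbertComplex 𝕜 W) (k : ℤ) :
    operatorRange (C.d k) ≤ operatorKernel (C.d (k + 1)) := by
  rintro _ ⟨v, rfl⟩
  exact mem_operatorKernel.2 ⟨C.d_mem k v, C.d_d k v⟩

instance completeSpace_operatorKernel (C : HilbertComplex 𝕜 W) (k : ℤ) :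
    CompleteSpace (operatorKernel (C.d k)) :=
  (isClosed_operatorKernel (C.isClosed_d k)).completeSpace_coe

theorem IsClosedComplex.completeSpace_operatorRange (hC : C.IsClosedComplex) (k : ℤ) :
    CompleteSpace (operatorRange (C.d k)) :=
  (hC k).completeSpace_coe

theorem IsClosedComplex.exists_isPartialInverse (hC : C.IsClosedComplex) (k : ℤ) :
    ∃ T, IsPartialInverse (C.d k) T :=
  _root_.exists_isPartialInverse (C.isClosed_d k) (hC k)

theorem CompactnessProperty.isCompactOperator_succ (hcompact : C.CompactnessProperty)
    (hC : C.IsClosedComplex) {k : ℤ} {T : W (k + 1 + 1) →L[𝕜] W (k + 1)}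
    (hT : IsPartialInverse (C.d (k + 1)) T) : IsCompactOperator T := by
  have := hC.completeSpace_operatorRange (k + 1)
  have hr : 0 < ‖T‖ + 1 := by positivity
  refine (isCompactOperator_iff_image_closedBall_subset_compact
    (T : W (k + 1 + 1) →ₗ[𝕜] W (k + 1)) (inv_pos.2 hr)).2 ⟨_, hcompact k, ?_⟩
  rintro _ ⟨g, hg, rfl⟩
  obtain ⟨hadj, hadj0⟩ := exists_adjoint_apply_eq_zero (C.dense_domain k)
    (Submodule.orthogonal_le (C.operatorRange_le_operatorKernel k) (hT.mem_orthogonal g))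
  refine subset_closure ⟨hT.mem_domain g, hadj, ?_⟩
  have hg1 : (‖T‖ + 1) * ‖g‖ ≤ 1 := by
    rw [← le_inv_mul_iff₀ hr, mul_one]
    exact mem_closedBall_zero_iff.1 hg
  calc ‖T g‖ ^ 2 + ‖C.d (k + 1) ⟨T g, hT.mem_domain g⟩‖ ^ 2 + ‖(C.d k).adjoint ⟨T g, hadj⟩‖ ^ 2
    _ = ‖T g‖ ^ 2 + ‖C.d (k + 1) ⟨T g, hT.mem_domain g⟩‖ ^ 2 := by
        rw [hadj0, norm_zero, zero_pow two_ne_zero, add_zero]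
    _ ≤ (‖T‖ ^ 2 + 1) * ‖g‖ ^ 2 := hT.norm_sq_add_norm_sq_le g
    _ ≤ ((‖T‖ + 1) * ‖g‖) ^ 2 := by
        rw [mul_pow]
        gcongr
        linarith [add_sq ‖T‖ 1, norm_nonneg T]
    _ ≤ 1 := pow_le_one₀ (by positivity) hg1

theorem CompactnessProperty.isCompactOperator (hcompact : C.CompactnessProperty)
    (hC : C.IsClosedComplex) {k : ℤ} {T : W (k + 1) →L[𝕜] W k}
    (hT : IsPartialInverse (C.d k) T) : IsCompactOperator T := by
  obtain ⟨j, rfl⟩ : ∃ j, k = j + 1 := ⟨k - 1, by ring⟩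
  exact hcompact.isCompactOperator_succ hC hT

variable {k : ℤ} {f f' : W (k + 1)} {σ σ' : (C.d k).domain} {u u' : (C.d (k + 1)).domain}
  {p p' : C.harmonic k}

protected theorem IsMixedSolution.sub (h : C.IsMixedSolution k f σ u p)
    (h' : C.IsMixedSolution k f' σ' u' p') :
    C.IsMixedSolution k (f - f') (σ - σ') (u - u') (p - p') := by
  refine ⟨fun τ => ?_, fun v => ?_, fun q => ?_⟩
  · rw [Submodule.coe_sub, Submodule.coe_sub, inner_sub_left, inner_sub_left, sub_sub_sub_comm,
      h.1 τ, h'.1 τ, sub_self]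
  · rw [LinearPMap.map_sub, LinearPMap.map_sub, Submodule.coe_sub, inner_sub_left, inner_sub_left,
      inner_sub_left, inner_sub_left, ← h.2.1 v, ← h'.2.1 v]
    ring
  · rw [Submodule.coe_sub, inner_sub_left, h.2.2 q, h'.2.2 q, sub_self]

theorem IsMixedSolution.norm_sq_add_norm_sq_eq_re_inner (h : C.IsMixedSolution k f σ u p) :
    ‖(σ : W k)‖ ^ 2 + ‖C.d (k + 1) u‖ ^ 2 = RCLike.re (inner 𝕜 f (u : W (k + 1))) := by
  have hσ : inner 𝕜 (σ : W k) (σ : W k) = inner 𝕜 (C.d k σ) (u : W (k + 1)) := by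
    rw [← inner_conj_symm, sub_eq_zero.1 (h.1 σ), inner_conj_symm]
  rw [← h.2.1 u, ← hσ, inner_eq_zero_symm.1 (h.2.2 p), add_zero, map_add, ← norm_sq_eq_re_inner,
    ← norm_sq_eq_re_inner]

theorem IsMixedSolution.eq_zero (h : C.IsMixedSolution k 0 σ u p) : (u : W (k + 1)) = 0 := by
  have henergy := h.norm_sq_add_norm_sq_eq_re_inner
  rw [inner_zero_left, map_zero, add_eq_zero_iff_of_nonneg (sq_nonneg _) (sq_nonneg _),
    sq_eq_zero_iff, sq_eq_zero_iff, norm_eq_zero, norm_eq_zero] at henergy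
  obtain ⟨hσ, hdu⟩ := henergy
  have hu : (u : W (k + 1)) ∈ (C.coboundaries k)ᗮ := by
    rintro _ ⟨τ, rfl⟩
    have hτ := h.1 τ
    rw [hσ, inner_zero_left, zero_sub, neg_eq_zero] at hτ
    exact inner_eq_zero_symm.1 hτ
  exact inner_self_eq_zero.1 (h.2.2 ⟨u, mem_operatorKernel.2 ⟨u.2, hdu⟩, hu⟩)

variable {T : W (k + 1) →L[𝕜] W k} {S : W (k + 1 + 1) →L[𝕜] W (k + 1)}

theorem IsClosedComplex.exists_isMixedSolution (hC : C.IsClosedComplex)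
    (hT : IsPartialInverse (C.d k) T) (hS : IsPartialInverse (C.d (k + 1)) S) (f : W (k + 1)) :
    ∃ (σ : (C.d k).domain) (hu : greenOperator T S f ∈ (C.d (k + 1)).domain) (p : C.harmonic k),
      C.IsMixedSolution k f σ ⟨greenOperator T S f, hu⟩ p := by
  have := hC.completeSpace_operatorRange
  have hle := C.operatorRange_le_operatorKernel k
  obtain ⟨hu, hdu⟩ := operator_greenOperator_apply hle hT hS f
  refine ⟨⟨T f, hT.mem_domain f⟩, hu,
    ⟨_, starProjection_sub_operator_apply_mem_harmonic hle hT f⟩, fun τ => ?_, fun v => ?_,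
    fun q => inner_greenOperator_harmonic hT hS f q.2⟩
  · rw [sub_eq_zero]
    exact (inner_greenOperator_operator hle hT hS f τ).symm
  · rw [hdu, hS.inner_adjoint_apply_operator f v, inner_sub_left, inner_sub_left]
    ring

theorem IsClosedComplex.isSolutionOperator_greenOperator (hC : C.IsClosedComplex)
    (hT : IsPartialInverse (C.d k) T) (hS : IsPartialInverse (C.d (k + 1)) S) :
    C.IsSolutionOperator k (greenOperator T S) := by
  intro f u
  obtain ⟨σ, hu, p, h⟩ := hC.exists_isMixedSolution hT hS f
  constructor
  · rintro rfl
    exact ⟨σ, hu, p, h⟩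
  · rintro ⟨σ', hu', p', h'⟩
    have hdiff := h.sub h'
    rw [sub_self] at hdiff
    exact sub_eq_zero.1 hdiff.eq_zero

end MixedProblem

section Eigenproblem

variable {𝕜 : Type*} [RCLike 𝕜] {W : ℤ → Type*} [∀ k, NormedAddCommGroup (W k)]
  [∀ k, InnerProductSpace 𝕜 (W k)] [∀ k, CompleteSpace (W k)] {C : HilbertComplex 𝕜 W} {k : ℤ}
  {K : W (k + 1) →L[𝕜] W (k + 1)} {N : ℕ∞} {lam : ℕ → ℝ} {u : ℕ → W (k + 1)}

theorem IsSolutionOperator.solvesEigenproblem_iff (hK : C.IsSolutionOperator k K) {t : 𝕜}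
    {v : W (k + 1)} : C.SolvesEigenproblem k t v ↔ t • K v = v := by
  rw [← map_smul]
  exact (hK (t • v) v).symm

theorem IsEigensystem.pos (h : C.IsEigensystem k N lam u) (hK : C.IsSolutionOperator k K)
    (hpos : K.IsPositive) {n : ℕ} (hn : (n : ℕ∞) < N) : 0 < lam n := by
  obtain ⟨s, hs, -, hlam⟩ := exists_pos_eigenvalue_of_smul_apply_eq hpos
    (hK.solvesEigenproblem_iff.1 (h.solves n hn)) (h.orthonormal.ne_zero ⟨n, hn⟩)
  rw [RCLike.ofReal_inj.1 hlam]
  exact inv_pos.2 hs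

open Classical in
/-- The eigenvalues of the solution operator that correspond to the first `N` members of a list of
eigenvalues of the eigenvalue problem, continued by zero. -/
noncomputable def inverseEigenvalue (N : ℕ∞) (lam : ℕ → ℝ) (n : ℕ) : ℝ :=
  if (n : ℕ∞) < N then (lam n)⁻¹ else 0

theorem inverseEigenvalue_of_lt {n : ℕ} (hn : (n : ℕ∞) < N) :
    inverseEigenvalue N lam n = (lam n)⁻¹ :=
  if_pos hn

theorem inverseEigenvalue_of_le {n : ℕ} (hn : N ≤ (n : ℕ∞)) : inverseEigenvalue N lam n = 0 :=
  if_neg hn.not_gt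

theorem IsEigensystem.antitone_inverseEigenvalue (h : C.IsEigensystem k N lam u)
    (hlam : ∀ n : ℕ, (n : ℕ∞) < N → 0 < lam n) : Antitone (inverseEigenvalue N lam) := by
  intro m n hmn
  rcases lt_or_ge (n : ℕ∞) N with hn | hn
  · have hm : (m : ℕ∞) < N := (Nat.cast_le.2 hmn).trans_lt hn
    rw [inverseEigenvalue_of_lt hn, inverseEigenvalue_of_lt hm]
    exact inv_anti₀ (hlam m hm) (h.monotone m n hmn hn)
  · rw [inverseEigenvalue_of_le hn]
    rcases lt_or_ge (m : ℕ∞) N with hm | hm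
    · rw [inverseEigenvalue_of_lt hm]
      exact (inv_pos.2 (hlam m hm)).le
    · rw [inverseEigenvalue_of_le hm]

theorem IsEigensystem.isSpectralSystem (h : C.IsEigensystem k N lam u)
    (hK : C.IsSolutionOperator k K) (hpos : K.IsPositive) :
    IsSpectralSystem (𝕜 := 𝕜) K N (inverseEigenvalue N lam) u where
  orthonormal := h.orthonormal
  antitone := h.antitone_inverseEigenvalue fun _ => h.pos hK hpos
  pos n hn := by
    rw [inverseEigenvalue_of_lt hn]
    exact inv_pos.2 (h.pos hK hpos hn)
  eq_zero _ := inverseEigenvalue_of_le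
  apply_eq n hn := by
    rw [inverseEigenvalue_of_lt hn, RCLike.ofReal_inv,
      eq_inv_smul_iff₀ (RCLike.ofReal_ne_zero.2 (h.pos hK hpos hn).ne')]
    exact hK.solvesEigenproblem_iff.1 (h.solves n hn)
  mem_span t v ht hv := by
    have hsolves : C.SolvesEigenproblem k ((t⁻¹ : ℝ) : 𝕜) v := by
      rw [hK.solvesEigenproblem_iff, hv, RCLike.ofReal_inv,
        inv_smul_smul₀ (RCLike.ofReal_ne_zero.2 ht.ne')]
    refine Submodule.span_mono ?_ (h.complete _ v hsolves)
    rintro _ ⟨n, hn, hnt, rfl⟩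
    exact ⟨n, hn, by rw [inverseEigenvalue_of_lt hn, RCLike.ofReal_inj.1 hnt, inv_inv], rfl⟩

theorem IsSolutionOperator.isEigensystem {μ : ℕ → ℝ} (hK : C.IsSolutionOperator k K)
    (hpos : K.IsPositive) (h : IsSpectralSystem (𝕜 := 𝕜) K N μ u) :
    C.IsEigensystem k N (fun n => (μ n)⁻¹) u where
  orthonormal := h.orthonormal
  monotone _ n hmn hn := inv_anti₀ (h.pos n hn) (h.antitone hmn)
  solves n hn := by
    rw [hK.solvesEigenproblem_iff, h.apply_eq n hn, RCLike.ofReal_inv,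
      inv_smul_smul₀ (RCLike.ofReal_ne_zero.2 (h.pos n hn).ne')]
  complete t v hv := by
    rcases eq_or_ne v 0 with rfl | hv0
    · exact zero_mem _
    obtain ⟨s, hs, hKv, rfl⟩ :=
      exists_pos_eigenvalue_of_smul_apply_eq hpos (hK.solvesEigenproblem_iff.1 hv) hv0
    refine Submodule.span_mono ?_ (h.mem_span s v hs hKv)
    rintro _ ⟨n, hn, rfl, rfl⟩
    exact ⟨n, hn, rfl, rfl⟩

theorem IsSolutionOperator.exists_isEigensystem (hK : C.IsSolutionOperator k K)
    (hcompact : IsCompactOperator K) (hpos : K.IsPositive) :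
    ∃ N lam u, C.IsEigensystem k N lam u := by
  obtain ⟨N, μ, u, hu⟩ := exists_isSpectralSystem hcompact hpos
  exact ⟨N, _, u, hK.isEigensystem hpos hu⟩

end Eigenproblem

section Convergence

variable {𝕜 ι : Type*} [RCLike 𝕜] {l : Filter ι}
  {W : ℤ → Type*} [∀ k, NormedAddCommGroup (W k)] [∀ k, InnerProductSpace 𝕜 (W k)]
  [∀ k, CompleteSpace (W k)] {C : HilbertComplex 𝕜 W}
  {Wh : ι → ℤ → Type*} [∀ h k, NormedAddCommGroup (Wh h k)]
  [∀ h k, InnerProductSpace 𝕜 (Wh h k)] [∀ h k, CompleteSpace (Wh h k)]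
  {Ch : ∀ h, HilbertComplex 𝕜 (Wh h)} {k : ℤ}

theorem eigenproblemsConverge {i : ∀ h, Wh h (k + 1) →L[𝕜] W (k + 1)}
    {π : ∀ h, W (k + 1) →L[𝕜] Wh h (k + 1)} {K : W (k + 1) →L[𝕜] W (k + 1)}
    {Kh : ∀ h, Wh h (k + 1) →L[𝕜] Wh h (k + 1)} (H : PositiveCompactConverge l i π K Kh)
    (hK : C.IsSolutionOperator k K) (hKh : ∀ h, (Ch h).IsSolutionOperator k (Kh h))
    {N : ℕ∞} {lam : ℕ → ℝ} {u : ℕ → W (k + 1)} {Nh : ι → ℕ∞} {lamh : ι → ℕ → ℝ}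
    {uh : ∀ h, ℕ → Wh h (k + 1)} (hu : C.IsEigensystem k N lam u)
    (huh : ∀ h, (Ch h).IsEigensystem k (Nh h) (lamh h) (uh h)) :
    EigenproblemsConverge (𝕜 := 𝕜) l i N lam u Nh lamh uh := by
  have hμ := hu.isSpectralSystem hK H.positive
  have hμh := fun h => (huh h).isSpectralSystem (hKh h) (H.positive_discrete h)
  have hpos : ∀ {n : ℕ}, (n : ℕ∞) < N → 0 < lam n := hu.pos hK H.positive
  refine ⟨fun n => H.eventually_lt_card hμ hμh, fun n hn => ?_, fun n hn M => ?_,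
    fun m hm hgap => H.tendsto_gap hμ hμh hm fun a ha => ?_⟩
  · have hlim := H.tendsto_eigenvalue hμ hμh n
    rw [inverseEigenvalue_of_lt hn] at hlim
    refine (inv_inv (lam n) ▸ hlim.inv₀ (inv_ne_zero (hpos hn).ne')).congr' ?_
    filter_upwards [H.eventually_lt_card hμ hμh hn] with h hnh
    rw [inverseEigenvalue_of_lt hnh, inv_inv]
  · have hlim := H.tendsto_eigenvalue hμ hμh n
    rw [inverseEigenvalue_of_le hn] at hlim
    filter_upwards [hlim.eventually_lt_const (show 0 < (|M| + 1)⁻¹ by positivity)] with h hlt hnh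
    rw [inverseEigenvalue_of_lt hnh, inv_lt_inv₀
      ((huh h).pos (hKh h) (H.positive_discrete h) hnh) (by positivity)] at hlt
    linarith [le_abs_self M]
  · have haN : (a : ℕ∞) < N := (Nat.cast_lt.2 ha).trans_le hm
    rw [inverseEigenvalue_of_lt haN]
    rcases lt_or_ge (m : ℕ∞) N with hmN | hmN
    · rw [inverseEigenvalue_of_lt hmN, inv_lt_inv₀ (hpos hmN) (hpos haN)]
      exact hgap a m ha le_rfl hmN
    · rw [inverseEigenvalue_of_le hmN]
      exact inv_pos.2 (hpos haN)

variable {i : ∀ h, Morphism (Ch h) C} {π : ∀ h, Morphism C (Ch h)}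

theorem isApproximation_toMap
    (hπi : ∀ h (w : Wh h k), (π h).toMap k ((i h).toMap k w) = w)
    (hi_bdd : UniformlyBounded fun h => (i h).toMap k)
    (hπ_bdd : UniformlyBounded fun h => (π h).toMap k)
    (happrox : ∀ v ∈ (C.d k).domain, Tendsto
      (fun h => Metric.infDist v ((i h).toMap k '' ((Ch h).d k).domain)) l (𝓝 0))
    (hJ : Tendsto (fun h => ‖ContinuousLinearMap.id 𝕜 (Wh h k)
      - adjoint ((i h).toMap k) ∘L (i h).toMap k‖) l (𝓝 0)) :
    IsApproximation l (fun h => (i h).toMap k) fun h => (π h).toMap k :=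
  .of_tendsto_infDist hπi hi_bdd hπ_bdd (C.dense_domain k)
    (fun v hv => squeeze_zero (fun _ => Metric.infDist_nonneg)
      (fun h => Metric.infDist_le_infDist_of_subset (Set.image_subset_range _ _)
        (((Ch h).d k).domain.nonempty.image _)) (happrox v hv)) hJ

theorem Morphism.intertwines {W' : ℤ → Type*} [∀ k, NormedAddCommGroup (W' k)]
    [∀ k, InnerProductSpace 𝕜 (W' k)] [∀ k, CompleteSpace (W' k)] {C' : HilbertComplex 𝕜 W'}
    (f : Morphism C C') (k : ℤ) :
    Intertwines (C.d k) (C'.d k) (f.toMap k) (f.toMap (k + 1)) :=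
  fun x => ⟨f.map_mem k x, f.comm k x⟩

theorem exists_positiveCompactConverge (hC : C.IsClosedComplex) (hcompact : C.CompactnessProperty)
    (hCh : ∀ h, (Ch h).IsClosedComplex)
    (H : ∀ k, IsApproximation l (fun h => (i h).toMap k) fun h => (π h).toMap k) (k : ℤ) :
    ∃ K Kh, C.IsSolutionOperator k K ∧ (∀ h, (Ch h).IsSolutionOperator k (Kh h)) ∧
      PositiveCompactConverge l (fun h => (i h).toMap (k + 1)) (fun h => (π h).toMap (k + 1))
        K Kh := by
  have := hC.completeSpace_operatorRange
  have := fun h => (hCh h).completeSpace_operatorRange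
  have Hd : ∀ j, IsOperatorApproximation l (C.d j) (fun h => (Ch h).d j) (fun h => (i h).toMap j)
      (fun h => (π h).toMap j) (fun h => (i h).toMap (j + 1)) fun h => (π h).toMap (j + 1) :=
    fun j => ⟨H j, H (j + 1), fun h => (i h).intertwines j, fun h => (π h).intertwines j⟩
  obtain ⟨T, hT⟩ := hC.exists_isPartialInverse k
  obtain ⟨S, hS⟩ := hC.exists_isPartialInverse (k + 1)
  choose Th hTh using fun h => (hCh h).exists_isPartialInverse k
  choose Sh hSh using fun h => (hCh h).exists_isPartialInverse (k + 1)
  exact ⟨_, _, hC.isSolutionOperator_greenOperator hT hS,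
    fun h => (hCh h).isSolutionOperator_greenOperator (hTh h) (hSh h),
    positiveCompactConverge_greenOperator (Hd k) (Hd (k + 1)) hT hTh hS hSh
      (hcompact.isCompactOperator hC hT) (hcompact.isCompactOperator hC hS)⟩

end Convergence

end HilbertComplex

theorem mainTheorem7 {𝕜 : Type*} [RCLike 𝕜]
    {W : ℤ → Type*} [∀ k, NormedAddCommGroup (W k)] [∀ k, InnerProductSpace 𝕜 (W k)]
    [∀ k, CompleteSpace (W k)]
    (C : HilbertComplex 𝕜 W) (hC : C.IsClosedComplex) (hcompact : C.CompactnessProperty)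
    {ι : Type*} (l : Filter ι)
    {Wh : ι → ℤ → Type*} [∀ h k, NormedAddCommGroup (Wh h k)]
    [∀ h k, InnerProductSpace 𝕜 (Wh h k)] [∀ h k, CompleteSpace (Wh h k)]
    (Ch : ∀ h, HilbertComplex 𝕜 (Wh h)) (hCh : ∀ h, (Ch h).IsClosedComplex)
    (i : ∀ h, HilbertComplex.Morphism (Ch h) C) (π : ∀ h, HilbertComplex.Morphism C (Ch h))
    (hπi : ∀ h k (w : Wh h k), (π h).toMap k ((i h).toMap k w) = w)
    (hi_bdd : ∀ k, ∃ c : ℝ, ∀ h, ‖(i h).toMap k‖ ≤ c)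
    (hπ_bdd : ∀ k, ∃ c : ℝ, ∀ h, ‖(π h).toMap k‖ ≤ c)
    (happrox : ∀ k, ∀ v ∈ (C.d k).domain, Tendsto
      (fun h => Metric.infDist v ((i h).toMap k '' ((Ch h).d k).domain)) l (𝓝 0))
    (hJ : ∀ k, Tendsto (fun h => ‖ContinuousLinearMap.id 𝕜 (Wh h k)
      - (ContinuousLinearMap.adjoint ((i h).toMap k)) ∘L ((i h).toMap k)‖) l (𝓝 0))
    (k : ℤ) :
    -- the solution operators exist and converge in the operator norm
    (∃ (K : W (k + 1) →L[𝕜] W (k + 1)) (Kh : ∀ h, Wh h (k + 1) →L[𝕜] Wh h (k + 1)),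
      C.IsSolutionOperator k K ∧ (∀ h, (Ch h).IsSolutionOperator k (Kh h)) ∧
      Tendsto (fun h => ‖K - (i h).toMap (k + 1) ∘L Kh h ∘L
        pulledBackProjection ((i h).toMap (k + 1)) ((π h).toMap (k + 1))‖) l (𝓝 0)) ∧
    -- the exact and the discrete eigenvalue problems have complete systems of eigenvectors
    (∃ N lam u, C.IsEigensystem k N lam u) ∧
    (∀ h, ∃ N lam u, (Ch h).IsEigensystem k N lam u) ∧
    -- whichever such systems are chosen, the discrete ones converge to the exact one
    (∀ N lam u Nh lamh uh, C.IsEigensystem k N lam u →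
      (∀ h, (Ch h).IsEigensystem k (Nh h) (lamh h) (uh h)) →
      EigenproblemsConverge (𝕜 := 𝕜) l (fun h => (i h).toMap (k + 1)) N lam u Nh lamh uh) := by
  obtain ⟨K, Kh, hK, hKh, H⟩ := HilbertComplex.exists_positiveCompactConverge hC hcompact hCh
    (fun j => HilbertComplex.isApproximation_toMap (fun h => hπi h j) (hi_bdd j) (hπ_bdd j)
      (happrox j) (hJ j)) k
  exact ⟨⟨K, Kh, hK, hKh, H.tendsto_comp_pulledBackProjection⟩,
    hK.exists_isEigensystem H.compact H.positive,
    fun h => (hKh h).exists_isEigensystem (H.compact_discrete h) (H.positive_discrete h),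
    fun _ _ _ _ _ _ hu huh => HilbertComplex.eigenproblemsConverge H hK hKh hu huh⟩
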